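/- Let $C$ be a smooth projective geometrically irreducible curve over a finite field $\mathbb F_q$ with $q$ elements, let $\infty\in C(\mathbb F_q)$, and let $A=\Gamma(C\smallsetminus\{\infty\},\mathcal O_C)$. Let $L$ be a field extension of $\mathbb F_q$ and $c^*:A\to L$ an $\mathbb F_q$-algebra homomorphism. Put $A_L=A\otimes_{\mathbb F_q}L$, let $J\subset A_L$ be the ideal generated by all $a\otimes 1-1\otimes c^*(a)$ with $a\in A$, let $\sigma^*$ be the endomorphism $a\otimes b\mapsto a\otimes b^q$ of $A_L$ (and likewise of $\mathcal O_{C_L}$, where $C_L=C\times_{\mathbb F_q}L$), and put $\sigma^*M=M\otimes_{A_L,\sigma^*}A_L$ for an $A_L$-module $M$. A pure $A$-motive $(M,\tau)$ of rank $r$, dimension $d$ and characteristic $c^*$ over $L$ consists of a locally free $A_L$-module $M$ of rank $r$ and an injective $A_L$-linear map $\tau:\sigma^*M\to M$ such that (1) $\operatorname{coker}\tau$ is an $L$-vector space of dimension $d$ and is annihilated by $J^d$; (2) $M$ extends to a locally free sheaf $\mathcal M$ of rank $r$ on $C_L$ such that for some positive integers $k,l$ the map $\tau^l=\tau\circ\sigma^*(\tau)\circ\dots\circ(\sigma^*)^{l-1}(\tau)$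 induces an isomorphism $(\sigma^*)^l\mathcal M_\infty\to\mathcal M(k\cdot\infty)_\infty$ of the stalks at $\infty$. A morphism $f:(M,\tau)\to(M',\tau')$ is an $A_L$-linear map $f:M\to M'$ with $f\circ\tau=\tau'\circ\sigma^*f$. It is an isogeny if it is injective with torsion cokernel. An isogeny is separable (respectively purely inseparable) if the induced map $\sigma^*\operatorname{coker}f\to\operatorname{coker}f$ is an isomorphism (respectively nilpotent, that is, for some $n$ its $n$-fold composite $(\sigma^*)^n\operatorname{coker}f\to\operatorname{coker}f$ is zero). All motives below have characteristic $c^*$ over $L$. (a) Let $(M,\tau)$ be a pure $A$-motive, and let $K$ be a finitely generated torsion $A_L$-module with an $A_L$-linear map $\tau_K:\sigma^*K\to K$ such that $\ker\tau_K$ and $\operatorname{coker}\tau_K$ are each annihilated by a power of $J$. Let $\rho:M\to K$ be a surjective $A_L$-linear map with $\tau_K\circ\sigma^*\rho=\rho\circ\tau$. Then $(M',\tau')=(\ker\rho,\tau|_{\sigma^*M'})$ is a pure $A$-motive of the same rank and dimension as $(M,\tau)$, and the inclusion $f:(M',\tau')\to(M,\tau)$ is an isogeny whose cokernel, with its induced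 map, is identified by $\rho$ with $(K,\tau_K)$. (b) Every isogeny $f$ from a pure $A$-motive $(M,\tau)$ to a pure $A$-motive $(M',\tau')$ can be factored as $f=f_{\rm insep}\circ f_{\rm sep}$ through a pure $A$-motive $(M'',\tau'')$, with a separable isogeny $f_{\rm sep}:M\to M''$ followed by a purely inseparable isogeny $f_{\rm insep}:M''\to M'$. (c) If $L$ is perfect, every such $f$ also has a factorization $f=f'_{\rm sep}\circ f'_{\rm insep}$ through a pure $A$-motive, with a purely inseparable isogeny $f'_{\rm insep}$ followed by a separable isogeny $f'_{\rm sep}$. -/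

import Mathlib

open scoped TensorProduct

universe u₁ u₂ u₃ u₄ u₅

/-! ### Frobenius pullback `σ^* M` of modules -/

section FrobeniusPullback

/-- A copy of the ring `R`, regarded as an `R`-algebra through the endomorphism `σ`. -/
def Twist {R : Type*} [CommRing R] (_σ : R →+* R) : Type _ := R

variable {R : Type*} [CommRing R] (σ : R →+* R)

instance : CommRing (Twist σ) := inferInstanceAs (CommRing R)

instance : Algebra R (Twist σ) := RingHom.toAlgebra (S := Twist σ) σ

/-- The identity of `R`, regarded as a ring homomorphism from `R` to its copy `Twist σ`. -/
def Twist.of : R →+* Twist σ := RingHom.id R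

/-- The pullback `σ^* M = M ⊗_{R,σ} R` (written with the factor `R` on the left), so that
`b ⊗ a m = b σ(a) ⊗ m`. -/
def SigmaPullback (M : Type*) [AddCommGroup M] [Module R M] : Type _ := Twist σ ⊗[R] M

namespace SigmaPullback

variable {M N : Type*} [AddCommGroup M] [Module R M] [AddCommGroup N] [Module R N]

instance : AddCommGroup (SigmaPullback σ M) := inferInstanceAs (AddCommGroup (Twist σ ⊗[R] M))

/-- The `R`-module structure of `σ^* M` comes from the factor `R`: `a (b ⊗ m) = a b ⊗ m`. -/
instance : Module R (SigmaPullback σ M) :=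
  Module.compHom (Twist σ ⊗[R] M) (Twist.of σ)

/-- The pure tensor `b ⊗ m` of `σ^* M`. -/
def tmul (b : R) (m : M) : SigmaPullback σ M := (Twist.of σ b) ⊗ₜ[R] m

theorem smul_tmul (a b : R) (m : M) : a • tmul σ b m = tmul σ (a * b) m := rfl

theorem tmul_smul (b a : R) (m : M) : tmul σ b (a • m) = tmul σ (b * σ a) m := by
  have h : (Twist.of σ b) ⊗ₜ[R] (a • m) = (a • Twist.of σ b) ⊗ₜ[R] m :=
    (TensorProduct.smul_tmul a (Twist.of σ b) m).symm
  rw [Algebra.smul_def, mul_comm] at h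
  exact h

theorem tmul_add (b : R) (m n : M) : tmul σ b (m + n) = tmul σ b m + tmul σ b n :=
  TensorProduct.tmul_add _ _ _

/-- The canonical `σ`-semilinear map `M → σ^* M`, `m ↦ 1 ⊗ m`. -/
def unit : M →ₛₗ[σ] SigmaPullback σ M where
  toFun m := tmul σ 1 m
  map_add' := tmul_add σ 1
  map_smul' a m := by rw [tmul_smul, smul_tmul, one_mul, mul_one]

theorem induction_on {p : SigmaPullback σ M → Prop} (x : SigmaPullback σ M) (zero : p 0)
    (tmul : ∀ b m, p (tmul σ b m)) (add : ∀ x y, p x → p y → p (x + y)) : p x :=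
  TensorProduct.induction_on (R := R) (M := Twist σ) (N := M) (motive := p) x zero tmul add

/-- The additive map underlying `lift`. -/
def liftAux (g : M →ₛₗ[σ] N) : SigmaPullback σ M →+ N :=
  TensorProduct.liftAddHom (R := R) (M := Twist σ) (N := M)
    (AddMonoidHom.mk' (fun b => AddMonoidHom.mk' (fun m => (show R from b) • g m)
        fun m n => by rw [map_add, smul_add])
      fun b b' => by ext m; exact add_smul (R := R) b b' (g m))
    fun a b m => by
      change (σ a * (show R from b)) • g m = (show R from b) • g (a • m)
      rw [map_smulₛₗ, smul_smul, mul_comm]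

/-- The `R`-linear map `σ^* M → N`, `b ⊗ m ↦ b g(m)`, attached to a `σ`-semilinear map
`g : M → N`. -/
def lift (g : M →ₛₗ[σ] N) : SigmaPullback σ M →ₗ[R] N where
  toFun := liftAux σ g
  map_add' := map_add _
  map_smul' a x := by
    rw [RingHom.id_apply]
    induction x using SigmaPullback.induction_on with
    | zero => rw [smul_zero, map_zero, smul_zero]
    | tmul b m => exact mul_smul (α := R) a b (g m)
    | add x y hx hy => rw [smul_add, map_add, map_add, hx, hy, smul_add]

theorem lift_tmul (g : M →ₛₗ[σ] N) (b : R) (m : M) : lift σ g (tmul σ b m) = b • g m := rfl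

/-- The pullback `σ^* f : σ^* M → σ^* N`, `b ⊗ m ↦ b ⊗ f(m)`, of a linear map `f : M → N`. -/
def map (f : M →ₗ[R] N) : SigmaPullback σ M →ₗ[R] SigmaPullback σ N :=
  lift σ ((unit σ).comp f)

theorem map_tmul (f : M →ₗ[R] N) (b : R) (m : M) : map σ f (tmul σ b m) = tmul σ b (f m) := by
  change b • tmul σ 1 (f m) = _
  rw [smul_tmul, mul_one]

end SigmaPullback

variable {σ} {M N : Type*} [AddCommGroup M] [Module R M] [AddCommGroup N] [Module R N]

/-- The `σ`-semilinear map `m ↦ τ(1 ⊗ m)` attached to a linear map `τ : σ^* M → M`. -/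
def semilinearOf (τ : SigmaPullback σ M →ₗ[R] M) : M →ₛₗ[σ] M :=
  τ.comp (SigmaPullback.unit σ)

/-- `f ∘ τ = τ' ∘ σ^* f`. -/
def IsTauMorphism (τ : SigmaPullback σ M →ₗ[R] M) (τ' : SigmaPullback σ N →ₗ[R] N)
    (f : M →ₗ[R] N) : Prop :=
  f ∘ₗ τ = τ' ∘ₗ SigmaPullback.map σ f

theorem IsTauMorphism.apply_semilinearOf {τ : SigmaPullback σ M →ₗ[R] M}
    {τ' : SigmaPullback σ N →ₗ[R] N} {f : M →ₗ[R] N} (hf : IsTauMorphism τ τ' f) (m : M) :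
    semilinearOf τ' (f m) = f (semilinearOf τ m) := by
  have h := LinearMap.congr_fun hf (SigmaPullback.tmul σ 1 m)
  rw [LinearMap.comp_apply, LinearMap.comp_apply, SigmaPullback.map_tmul] at h
  exact h.symm

/-- The homomorphism `σ^* (coker f) → coker f` induced by `τ'`, for a morphism
`f : (M, τ) → (N, τ')`. -/
def cokerTau {τ : SigmaPullback σ M →ₗ[R] M} {τ' : SigmaPullback σ N →ₗ[R] N} {f : M →ₗ[R] N}
    (hf : IsTauMorphism τ τ' f) :
    SigmaPullback σ (N ⧸ LinearMap.range f) →ₗ[R] (N ⧸ LinearMap.range f) :=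
  SigmaPullback.lift σ ((LinearMap.range f).mapQ (LinearMap.range f) (semilinearOf τ') (by
    rintro _ ⟨m, rfl⟩
    exact ⟨semilinearOf τ m, (hf.apply_semilinearOf m).symm⟩))

/-- `τ : σ^* M → M` is nilpotent: for some `n` the `n`-fold composite
`τ ∘ σ^* τ ∘ ⋯ ∘ (σ^*)^{n-1} τ : (σ^*)^n M → M` vanishes. The image of this composite is generated
by the values of the `n`-th iterate of the semilinear map `m ↦ τ(1 ⊗ m)`. -/
def IsTauNilpotent (τ : SigmaPullback σ M →ₗ[R] M) : Prop :=
  ∃ n : ℕ, ∀ m : M, (semilinearOf τ)^[n] m = 0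

/-- An isogeny `f : (M, τ) → (N, τ')`: an injective morphism with torsion cokernel. -/
structure IsIsogeny (τ : SigmaPullback σ M →ₗ[R] M) (τ' : SigmaPullback σ N →ₗ[R] N)
    (f : M →ₗ[R] N) : Prop where
  isTauMorphism : IsTauMorphism τ τ' f
  injective : Function.Injective f
  torsion : Module.IsTorsion R (N ⧸ LinearMap.range f)

/-- A separable isogeny: the induced map `σ^* (coker f) → coker f` is an isomorphism. -/
structure IsSeparableIsogeny (τ : SigmaPullback σ M →ₗ[R] M) (τ' : SigmaPullback σ N →ₗ[R] N)
    (f : M →ₗ[R] N) : Prop extends IsIsogeny τ τ' f where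
  bijective : Function.Bijective (cokerTau isTauMorphism)

/-- A purely inseparable isogeny: the induced map `σ^* (coker f) → coker f` is nilpotent. -/
structure IsPurelyInseparableIsogeny (τ : SigmaPullback σ M →ₗ[R] M)
    (τ' : SigmaPullback σ N →ₗ[R] N) (f : M →ₗ[R] N) : Prop extends IsIsogeny τ τ' f where
  nilpotent : IsTauNilpotent (cokerTau isTauMorphism)

end FrobeniusPullback

/-! ### The curve `C` and the rational point `∞` -/

/-- `Q` is the function field of a smooth projective geometrically irreducible curve over the
finite field `Fq`: a finitely generated field extension of transcendence degree one in which `Fq`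
is algebraically closed. The curve is determined by `Q` up to isomorphism, and the local rings at
its closed points are the valuation rings of `Q` that contain `Fq` and differ from `Q`. -/
structure IsCurveFunctionField (Fq Q : Type*) [Field Fq] [Field Q] [Algebra Fq Q] : Prop where
  exists_finite : ∃ x : Q, Transcendental Fq x ∧
    FiniteDimensional (IntermediateField.adjoin Fq {x}) Q
  constants : ∀ y : Q, IsAlgebraic Fq y → ∃ a : Fq, algebraMap Fq Q a = y

/-- An `Fq`-rational point of the curve with function field `Q`, given by its local ring: a
valuation ring of `Q`, different from `Q`, which contains `Fq` and has residue field `Fq`. -/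
structure RationalPoint (Fq Q : Type*) [Field Fq] [Field Q] [Algebra Fq Q] where
  localRing : ValuationSubring Q
  ne_top : localRing ≠ ⊤
  algebraMap_mem : ∀ a : Fq, algebraMap Fq Q a ∈ localRing
  residue : ∀ f ∈ localRing, ∃ a : Fq, f - algebraMap Fq Q a ∈ localRing.nonunits

namespace RationalPoint

variable {Fq Q : Type*} [Field Fq] [Field Q] [Algebra Fq Q] (P : RationalPoint Fq Q)

instance : Algebra Fq P.localRing :=
  ((algebraMap Fq Q).codRestrict P.localRing.toSubring P.algebraMap_mem).toAlgebra

/-- The inclusion of the local ring at the point into the function field. -/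
def localRingVal : P.localRing →ₐ[Fq] Q where
  toRingHom := P.localRing.subtype
  commutes' _ := rfl

/-- The ring `A = Γ(C ∖ {∞}, 𝒪_C)`: the functions which are regular at every closed point
different from `∞`. -/
def ringAway : Subalgebra Fq Q where
  carrier := {f | ∀ v : ValuationSubring Q, v ≠ ⊤ → (∀ a : Fq, algebraMap Fq Q a ∈ v) →
    v ≠ P.localRing → f ∈ v}
  mul_mem' hf hg v h₁ h₂ h₃ := mul_mem (hf v h₁ h₂ h₃) (hg v h₁ h₂ h₃)
  add_mem' hf hg v h₁ h₂ h₃ := add_mem (hf v h₁ h₂ h₃) (hg v h₁ h₂ h₃)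
  algebraMap_mem' a _ _ h₂ _ := h₂ a

end RationalPoint

/-! ### Base change to `L` -/

section BaseChange

variable {Fq Q : Type*} [Field Fq] [Field Q] [Algebra Fq Q]

/-- The endomorphism `σ^*` of `B_L = L ⊗ B`: the identity on `B` and the `q`-Frobenius on `L`. -/
def sigmaHom (Fq L B : Type*) [Field Fq] [Fintype Fq] [Field L] [Algebra Fq L] [CommRing B]
    [Algebra Fq B] : L ⊗[Fq] B →+* L ⊗[Fq] B :=
  (Algebra.TensorProduct.map (FiniteField.frobeniusAlgHom Fq L) (AlgHom.id Fq B)).toRingHom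

theorem sigmaHom_tmul (Fq L B : Type*) [Field Fq] [Fintype Fq] [Field L] [Algebra Fq L]
    [CommRing B] [Algebra Fq B] (b : L) (a : B) :
    sigmaHom Fq L B (b ⊗ₜ a) = (b ^ Fintype.card Fq) ⊗ₜ a := rfl

theorem sigmaHom_flat (Fq L B : Type*) [Field Fq] [Fintype Fq] [Field L] [Algebra Fq L]
    [CommRing B] [Algebra Fq B] : (sigmaHom Fq L B).Flat :=
  RingHom.Flat.tensorProductMap (RingHom.Flat.of_isField (Field.toIsField L) _)
    (RingHom.Flat.id B)

theorem sigmaHom_nonZeroDivisors (Fq L B : Type*) [Field Fq] [Fintype Fq] [Field L]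
    [Algebra Fq L] [CommRing B] [Algebra Fq B] :
    nonZeroDivisors (L ⊗[Fq] B) ≤ (nonZeroDivisors (L ⊗[Fq] B)).comap (sigmaHom Fq L B) := by
  intro b hb
  have h := sigmaHom_flat Fq L B
  have hflat : Module.Flat (L ⊗[Fq] B) (Twist (sigmaHom Fq L B)) := h
  have hreg := Module.Flat.isSMulRegular_of_nonZeroDivisors
    (M := Twist (sigmaHom Fq L B)) hb
  rw [Submonoid.mem_comap, mem_nonZeroDivisors_iff_right]
  intro x hx
  refine hreg (a₁ := x) (a₂ := (0 : L ⊗[Fq] B)) ?_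
  change sigmaHom Fq L B b * x = sigmaHom Fq L B b * 0
  rw [mul_comm, hx, mul_zero]

namespace RationalPoint

variable (P : RationalPoint Fq Q) (L : Type*) [Field L] [Algebra Fq L]

/-- The ring `A_L = A ⊗ L`, written with the factor `L` on the left. -/
abbrev AL : Type _ := L ⊗[Fq] P.ringAway

/-- The function field of `C_L`: the fraction field of `Q ⊗ L`. -/
def KL (_P : RationalPoint Fq Q) (L : Type*) [Field L] [Algebra Fq L] : Type _ :=
  FractionRing (L ⊗[Fq] Q)

instance : CommRing (P.KL L) := inferInstanceAs (CommRing (FractionRing (L ⊗[Fq] Q)))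

instance algebraQL : Algebra (L ⊗[Fq] Q) (P.KL L) :=
  inferInstanceAs (Algebra (L ⊗[Fq] Q) (FractionRing (L ⊗[Fq] Q)))

instance : IsFractionRing (L ⊗[Fq] Q) (P.KL L) :=
  inferInstanceAs (IsFractionRing (L ⊗[Fq] Q) (FractionRing (L ⊗[Fq] Q)))

instance algebraAL : Algebra (P.AL L) (P.KL L) :=
  ((algebraMap (L ⊗[Fq] Q) (P.KL L)).comp
    (Algebra.TensorProduct.map (AlgHom.id Fq L) P.ringAway.val).toRingHom).toAlgebra

/-- The inclusion of `𝒪_{C,∞} ⊗ L` into the function field of `C_L`. -/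
def localToKL : L ⊗[Fq] P.localRing →+* P.KL L :=
  (algebraMap (L ⊗[Fq] Q) (P.KL L)).comp
    (Algebra.TensorProduct.map (AlgHom.id Fq L) P.localRingVal).toRingHom

/-- The ideal of `𝒪_{C,∞} ⊗ L` which defines the point `∞` of `C_L`; it is generated by the
maximal ideal of `𝒪_{C,∞}`. -/
def idealInfty : Ideal (L ⊗[Fq] P.localRing) :=
  (IsLocalRing.maximalIdeal P.localRing).map
    (Algebra.TensorProduct.includeRight : P.localRing →ₐ[Fq] L ⊗[Fq] P.localRing)

/-- The local ring `𝒪_{C_L,∞}` inside the function field of `C_L`: the fractions `a / b` with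
`a, b ∈ 𝒪_{C,∞} ⊗ L` and `b` not vanishing at `∞`, that is, `b` a unit modulo the ideal of `∞`
(the quotient by this ideal is the residue field `L`). -/
def localRingL : Subring (P.KL L) where
  carrier := {x | ∃ a b : L ⊗[Fq] P.localRing,
    IsUnit (Ideal.Quotient.mk (P.idealInfty L) b) ∧ x * P.localToKL L b = P.localToKL L a}
  mul_mem' := by
    rintro x y ⟨a, b, hb, hx⟩ ⟨a', b', hb', hy⟩
    refine ⟨a * a', b * b', by rw [map_mul]; exact hb.mul hb', ?_⟩
    rw [map_mul, map_mul, ← hx, ← hy]; ring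
  one_mem' := ⟨1, 1, by rw [map_one]; exact isUnit_one, by rw [map_one, mul_one]⟩
  add_mem' := by
    rintro x y ⟨a, b, hb, hx⟩ ⟨a', b', hb', hy⟩
    refine ⟨a * b' + a' * b, b * b', by rw [map_mul]; exact hb.mul hb', ?_⟩
    rw [map_add, map_mul, map_mul, map_mul, ← hx, ← hy]; ring
  zero_mem' := ⟨0, 1, by rw [map_one]; exact isUnit_one, by rw [map_zero, zero_mul]⟩
  neg_mem' := by
    rintro x ⟨a, b, hb, hx⟩
    exact ⟨-a, b, hb, by rw [map_neg, ← hx, neg_mul]⟩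

variable [Fintype Fq]

/-- The endomorphism `σ^*` of `A_L`, `a ⊗ b ↦ a ⊗ b^q`. -/
abbrev sigma : P.AL L →+* P.AL L := sigmaHom Fq L P.ringAway

/-- The endomorphism `σ^*` of the function field of `C_L`. -/
noncomputable def sigmaK : P.KL L →+* P.KL L :=
  IsLocalization.map (M := nonZeroDivisors (L ⊗[Fq] Q)) (T := nonZeroDivisors (L ⊗[Fq] Q))
    (P.KL L) (sigmaHom Fq L Q) (sigmaHom_nonZeroDivisors Fq L Q)

theorem sigmaK_algebraMap (a : P.AL L) :
    P.sigmaK L (algebraMap (P.AL L) (P.KL L) a) = algebraMap (P.AL L) (P.KL L) (P.sigma L a) := by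
  have h : (sigmaHom Fq L Q).comp
      (Algebra.TensorProduct.map (AlgHom.id Fq L) P.ringAway.val).toRingHom =
      (Algebra.TensorProduct.map (AlgHom.id Fq L) P.ringAway.val).toRingHom.comp (P.sigma L) := by
    ext <;> simp [sigmaHom]
  change P.sigmaK L (algebraMap (L ⊗[Fq] Q) (P.KL L) _) = algebraMap (L ⊗[Fq] Q) (P.KL L) _
  rw [sigmaK, IsLocalization.map_eq]
  exact congrArg _ (RingHom.congr_fun h a)

/-- `σ^*` on the function field, as a map which is semilinear over `σ^*` on `A_L`. -/
noncomputable def sigmaKₛₗ : P.KL L →ₛₗ[P.sigma L] P.KL L where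
  toFun := P.sigmaK L
  map_add' := map_add _
  map_smul' a x := by
    rw [Algebra.smul_def, map_mul, sigmaK_algebraMap, ← Algebra.smul_def]

/-- The generic fibre `M ⊗_{A_L} Q(C_L)` of an `A_L`-module `M`. -/
def GenericFibre (M : Type*) [AddCommGroup M] [Module (P.AL L) M] : Type _ :=
  P.KL L ⊗[P.AL L] M

variable {L} {M : Type*} [AddCommGroup M] [Module (P.AL L) M]

instance : AddCommGroup (P.GenericFibre L M) :=
  inferInstanceAs (AddCommGroup (P.KL L ⊗[P.AL L] M))

instance : Module (P.KL L) (P.GenericFibre L M) :=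
  inferInstanceAs (Module (P.KL L) (P.KL L ⊗[P.AL L] M))

/-- The extension of `τ` to the generic fibre, as the `σ^*`-semilinear map
`x ⊗ m ↦ σ^*(x) ⊗ τ(1 ⊗ m)`. -/
noncomputable def genericTau (τ : SigmaPullback (P.sigma L) M →ₗ[P.AL L] M) :
    P.GenericFibre L M → P.GenericFibre L M :=
  TensorProduct.map (P.sigmaKₛₗ L) (semilinearOf τ)

/-- The stalk `ℳ(k · ∞)_∞` inside the generic fibre, for a sheaf `ℳ` with stalk `ℳ_∞ = Λ`: the
elements which every element of the `k`-th power of the maximal ideal of `𝒪_{C,∞}` (equivalently,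
`z^k` for a uniformizer `z`) multiplies into `Λ`. -/
def poleTwist (Λ : Submodule (P.localRingL L) (P.GenericFibre L M)) (k : ℕ) :
    Set (P.GenericFibre L M) :=
  {x | ∀ a ∈ IsLocalRing.maximalIdeal P.localRing ^ k, P.localToKL L (1 ⊗ₜ a) • x ∈ Λ}

/-- The purity condition. A locally free sheaf `ℳ` on `C_L` which extends `M` is the same as its
stalk `Λ = ℳ_∞` at `∞`, a finitely generated `𝒪_{C_L,∞}`-submodule of the generic fibre of `M` which
spans it. For some such `ℳ` and some positive `k` and `l`, the `l`-th power
`τ^l : (σ^*)^l M → M` shall induce an isomorphism `(σ^*)^l ℳ_∞ → ℳ(k · ∞)_∞`. As `τ^l` is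
injective, this says that the image of `(σ^*)^l ℳ_∞`, which is the `𝒪_{C_L,∞}`-span of `τ^l(ℳ_∞)`
for the semilinear `τ`, is `ℳ(k · ∞)_∞`. -/
def IsPureAtInfinity (τ : SigmaPullback (P.sigma L) M →ₗ[P.AL L] M) : Prop :=
  ∃ (Λ : Submodule (P.localRingL L) (P.GenericFibre L M)) (k l : ℕ),
    Λ.FG ∧ Submodule.span (P.KL L) (Λ : Set (P.GenericFibre L M)) = ⊤ ∧ 0 < k ∧ 0 < l ∧
    (Submodule.span (P.localRingL L) ((P.genericTau τ)^[l] '' Λ) : Set (P.GenericFibre L M)) =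
      P.poleTwist Λ k

/-! ### Pure `A`-motives -/

/-- The ideal `J` of `A_L` generated by the `a ⊗ 1 - 1 ⊗ c^*(a)` for `a ∈ A`. -/
def idealJ (c : P.ringAway →ₐ[Fq] L) : Ideal (P.AL L) :=
  Ideal.span (Set.range fun a : P.ringAway => (1 : L) ⊗ₜ[Fq] a - c a ⊗ₜ[Fq] (1 : P.ringAway))

/-- `(M, τ)` is a pure `A`-motive of rank `r`, dimension `d` and characteristic `c^*` over `L`. -/
structure IsPureAMotive (c : P.ringAway →ₐ[Fq] L) (r d : ℕ)
    (τ : SigmaPullback (P.sigma L) M →ₗ[P.AL L] M) : Prop where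
  finite : Module.Finite (P.AL L) M
  projective : Module.Projective (P.AL L) M
  rank_eq : ∀ p : PrimeSpectrum (P.AL L), Module.rankAtStalk M p = r
  injective : Function.Injective τ
  coker_finite : Module.Finite L (RestrictScalars L (P.AL L) (M ⧸ LinearMap.range τ))
  coker_dim : Module.finrank L (RestrictScalars L (P.AL L) (M ⧸ LinearMap.range τ)) = d
  coker_annihilated : P.idealJ c ^ d ≤ Module.annihilator (P.AL L) (M ⧸ LinearMap.range τ)
  pure : P.IsPureAtInfinity τ

end RationalPoint

/-- A pure `A`-motive of characteristic `c^*` over `L`, of some rank and dimension. -/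
structure PureAMotive {Fq Q L : Type*} [Field Fq] [Fintype Fq] [Field Q] [Algebra Fq Q] [Field L]
    [Algebra Fq L] (P : RationalPoint Fq Q) (c : P.ringAway →ₐ[Fq] L) where
  carrier : Type*
  [addCommGroup : AddCommGroup carrier]
  [module : Module (P.AL L) carrier]
  rank : ℕ
  dim : ℕ
  tau : SigmaPullback (P.sigma L) carrier →ₗ[P.AL L] carrier
  isPureAMotive : P.IsPureAMotive c rank dim tau

attribute [instance] PureAMotive.addCommGroup PureAMotive.module

end BaseChange

/-! Everything reduces to one principle. `A_L` is a Dedekind domain whose quotients by nonzero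
ideals are finite-dimensional over `L`. If `N → M` is an isogeny into a pure motive and some power
of `J` annihilates the cokernel of `τ_N`, then `N` is a pure motive of the same rank and dimension
(`IsPureAMotive.of_isIsogeny`). Indeed `N` is a finite torsion-free module, hence projective; it has
the same generic fibre with `τ` as `M`, so rank and purity carry over; `τ_N` is injective because
`σ` is flat. Computing `dim M / τ(σ^* N)` through `N` and through `τ(σ^* M)` shows that the two
cokernels have equal dimension, since `σ^*` preserves dimensions over `L`
(`FiniteOver.sigmaPullback`, `dimOver_coker_eq`). An ideal acting nilpotently on a `d`-dimensional
module has vanishing `d`-th power on it, so the exponent `d` for `J` comes for free.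

In each of the three statements a `τ`-stable submodule has to be chosen and its cokernel killed by a
power of `J`. For (a) this is the stretch `ker τ_K → coker τ' → coker τ` of the snake lemma. For (b)
and (c) it is Fitting's lemma for the semilinear map `ψ` on the finite-dimensional `coker f`. In (b)
the submodule is the preimage of the stable image of `ψ`: there the linearization of `ψ` is
surjective, hence bijective by dimension, and the quotient is nilpotent. In (c) it is the preimage
of the stable kernel. Then `ψ` is injective on the quotient, and its linearization is injective as
well, because over a perfect `L` the map `σ` is surjective and every element of `σ^* K` has the form
`1 ⊗ m`.

The Dedekind property takes the most work. Smooth base change and localization preserve integral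
closedness, hence so does any extension of a perfect field (`PreservesIntClosed.of_perfectField`).
Idempotents are integral, so `L ⊗ Q` has only trivial ones; being étale over a normal domain, it is
then a normal domain, and so is `A_L`. Noetherianity, dimension at most one and finite quotients
follow once `A` is finite over some polynomial ring. -/

/-! ### Base change of integrally closed subrings -/

section IntegrallyClosedBaseChange

/-- `R → B` is integrally closed: every element of `B` which is integral over `R` comes
from `R`. -/
def RingHom.IsIntClosed {R B : Type*} [CommRing R] [CommRing B] (f : R →+* B) : Prop :=
  ∀ b : B, f.IsIntegralElem b → b ∈ f.range

universe w₁ w₂ in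
/-- The base change from `k` to `T` preserves integrally closed homomorphisms. -/
def PreservesIntClosed (k T : Type*) [CommRing k] [CommRing T] [Algebra k T] : Prop :=
  ∀ (R : Type w₁) (B : Type w₂) [CommRing R] [CommRing B] [Algebra k R] [Algebra k B]
    (f : R →ₐ[k] B), f.toRingHom.IsIntClosed →
      (Algebra.TensorProduct.map (AlgHom.id k T) f).toRingHom.IsIntClosed

theorem RingHom.IsIntegralElem.map_of_comp_eq {R B R' B' : Type*} [CommRing R] [CommRing B]
    [CommRing R'] [CommRing B'] {f : R →+* B} {f' : R' →+* B'} (g : R →+* R') (h : B →+* B')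
    (comm : h.comp f = f'.comp g) {b : B} (hb : f.IsIntegralElem b) : f'.IsIntegralElem (h b) := by
  obtain ⟨p, hp, hpb⟩ := hb
  refine ⟨p.map g, hp.map g, ?_⟩
  rw [Polynomial.eval₂_map, ← comm, ← Polynomial.hom_eval₂, hpb, map_zero]

/-- By hypothesis the integral closure of `R ⊗ T` in `(R ⊗ T) ⊗_R B` is spanned by the `s ⊗ b` with
`b` integral over `R`. Such a `b` comes from `R` and can be moved into the left factor. The map `e`
identifies `T ⊗_k B` with `(R ⊗ T) ⊗_R B`. -/
theorem preservesIntClosed_of_toIntegralClosure {k T R B : Type*} [CommRing k] [CommRing T]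
    [Algebra k T] [CommRing R] [CommRing B] [Algebra k R] [Algebra k B] (f : R →ₐ[k] B)
    (h : ∀ [Algebra R B], Function.Bijective (TensorProduct.toIntegralClosure R (R ⊗[k] T) B))
    (hf : f.toRingHom.IsIntClosed) :
    (Algebra.TensorProduct.map (AlgHom.id k T) f).toRingHom.IsIntClosed := by
  algebraize [f.toRingHom]
  have : IsScalarTower k R B := .of_algebraMap_eq' f.comp_algebraMap.symm
  intro z hz
  let e : T ⊗[k] B →+* (R ⊗[k] T) ⊗[R] B :=
    (Algebra.TensorProduct.comm R B (R ⊗[k] T)).toRingEquiv.toRingHom.comp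
      ((Algebra.TensorProduct.cancelBaseChange k R R B T).symm.toRingEquiv.toRingHom.comp
        (Algebra.TensorProduct.comm k T B).toRingEquiv.toRingHom)
  have he : Function.Injective e :=
    (Algebra.TensorProduct.comm R B (R ⊗[k] T)).injective.comp
      ((Algebra.TensorProduct.cancelBaseChange k R R B T).symm.injective.comp
        (Algebra.TensorProduct.comm k T B).injective)
  have comm : e.comp (Algebra.TensorProduct.map (AlgHom.id k T) f).toRingHom =
      (algebraMap (R ⊗[k] T) ((R ⊗[k] T) ⊗[R] B)).comp
        (Algebra.TensorProduct.comm k T R).toRingEquiv.toRingHom := by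
    ext x
    · simp [e]
    · have : (1 : R ⊗[k] T) ⊗ₜ[R] (f x) = (x ⊗ₜ[k] (1 : T)) ⊗ₜ[R] (1 : B) := by
        have : f x = x • (1 : B) := by rw [Algebra.smul_def, mul_one]; rfl
        rw [this, ← TensorProduct.smul_tmul, Algebra.TensorProduct.one_def, TensorProduct.smul_tmul',
          smul_eq_mul, mul_one]
      rw [Algebra.TensorProduct.one_def] at this
      simpa [e] using this
  have hw := hz.map_of_comp_eq _ _ comm
  obtain ⟨u, hu⟩ := h.2 ⟨e z, hw⟩
  replace hu : ((TensorProduct.toIntegralClosure R (R ⊗[k] T) B u :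
    integralClosure (R ⊗[k] T) ((R ⊗[k] T) ⊗[R] B)) : (R ⊗[k] T) ⊗[R] B) = e z := by rw [hu]
  have key : ((TensorProduct.toIntegralClosure R (R ⊗[k] T) B u :
      integralClosure (R ⊗[k] T) ((R ⊗[k] T) ⊗[R] B)) : (R ⊗[k] T) ⊗[R] B) ∈
      (algebraMap (R ⊗[k] T) ((R ⊗[k] T) ⊗[R] B)).range := by
    clear hu
    induction u with
    | zero => simp
    | add x y hx hy => rw [map_add]; exact add_mem hx hy
    | tmul s b =>
      obtain ⟨r, hr⟩ := hf b.1 b.2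
      refine ⟨r • s, ?_⟩
      change (r • s) ⊗ₜ[R] (1 : B) = s ⊗ₜ[R] b.1
      rw [← hr, TensorProduct.smul_tmul]
      congr 1
      rw [Algebra.smul_def, mul_one]; rfl
  rw [hu] at key
  obtain ⟨y, hy⟩ := key
  obtain ⟨y, rfl⟩ := (Algebra.TensorProduct.comm k T R).surjective y
  exact ⟨y, he (by rw [← RingHom.comp_apply, comm]; exact hy)⟩

theorem PreservesIntClosed.of_smooth (k T : Type*) [CommRing k] [CommRing T] [Algebra k T]
    [Algebra.Smooth k T] : PreservesIntClosed k T := fun R B _ _ _ _ f =>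
  preservesIntClosed_of_toIntegralClosure f
    (TensorProduct.toIntegralClosure_bijective_of_smooth (R := R) (B := B))

theorem PreservesIntClosed.of_isLocalization {k : Type*} (T : Type*) [CommRing k] [CommRing T]
    [Algebra k T] (M : Submonoid k) [IsLocalization M T] : PreservesIntClosed k T :=
  fun R B _ _ _ _ f =>
  preservesIntClosed_of_toIntegralClosure f
    (TensorProduct.toIntegralClosure_bijective_of_isLocalization (R := R) (B := B)
      (Algebra.algebraMapSubmonoid R M))

theorem RingHom.IsIntClosed.of_equiv {R B R' B' : Type*} [CommRing R] [CommRing B]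
    [CommRing R'] [CommRing B'] {f : R →+* B} {f' : R' →+* B'} (hf : f.IsIntClosed)
    (g : R' ≃+* R) (h : B' ≃+* B) (comm : h.toRingHom.comp f' = f.comp g.toRingHom) :
    f'.IsIntClosed := by
  intro b hb
  obtain ⟨r, hr⟩ := hf _ (hb.map_of_comp_eq _ _ comm)
  refine ⟨g.symm r, h.injective ?_⟩
  have := RingHom.congr_fun comm (g.symm r)
  simp only [RingHom.comp_apply] at this
  refine this.trans ?_
  simpa using hr

universe v₁ v₂ v₃ w₁ w₂ in
theorem PreservesIntClosed.trans {k : Type v₁} {T : Type v₂} {T' : Type v₃} [CommRing k]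
    [CommRing T] [CommRing T'] [Algebra k T] [Algebra k T'] [Algebra T T'] [IsScalarTower k T T']
    (h : PreservesIntClosed.{w₁, w₂} k T)
    (h' : PreservesIntClosed.{max v₂ w₁, max v₂ w₂} T T') :
    PreservesIntClosed.{w₁, w₂} k T' := by
  intro R B _ _ _ _ f hf
  refine (h' (T ⊗[k] R) (T ⊗[k] B) (Algebra.TensorProduct.map (AlgHom.id T T) f)
    (h R B f hf)).of_equiv
    (Algebra.TensorProduct.cancelBaseChange k T T T' R).symm.toRingEquiv
    (Algebra.TensorProduct.cancelBaseChange k T T T' B).symm.toRingEquiv ?_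
  ext <;> simp

-- Over a perfect field `L` is separably generated. So `k → L` is a polynomial ring, followed by its
-- fraction field, followed by a finite étale extension, and each of the three steps preserves
-- integral closedness.
open scoped IntermediateField.algebraAdjoinAdjoin in
theorem PreservesIntClosed.of_essFiniteType (k L : Type*) [Field k] [PerfectField k] [Field L]
    [Algebra k L] [Algebra.EssFiniteType k L] : PreservesIntClosed k L := by
  obtain ⟨s, hs, H⟩ := exists_isTranscendenceBasis_and_isSeparable_of_perfectField k L
  have hs' := hs.1
  have e := hs'.aevalEquiv
  rw [Subtype.range_coe_subtype, Finset.setOfPred_mem] at e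
  have : Algebra.Smooth k (MvPolynomial s k) :=
    ⟨inferInstance, inferInstance⟩
  have : Algebra.Smooth k (Algebra.adjoin k (s : Set L)) := .of_equiv e
  have : Algebra.EssFiniteType (IntermediateField.adjoin k (s : Set L)) L :=
    .of_comp k _ _
  have : Algebra.FormallyEtale (IntermediateField.adjoin k (s : Set L)) L :=
    .of_isSeparable _ L
  have : Module.Finite (IntermediateField.adjoin k (s : Set L)) L :=
    Algebra.FormallyUnramified.finite_of_free _ _
  have : Algebra.Smooth (IntermediateField.adjoin k (s : Set L)) L := ⟨inferInstance,
    Algebra.FinitePresentation.of_finiteType.mp inferInstance⟩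
  exact (PreservesIntClosed.of_smooth k (Algebra.adjoin k (s : Set L))).trans
    ((PreservesIntClosed.of_isLocalization (IntermediateField.adjoin k (s : Set L))
      (nonZeroDivisors (Algebra.adjoin k (s : Set L)))).trans
        (PreservesIntClosed.of_smooth _ L))

theorem exists_finset_mem_range_map {k L B : Type*} [Field k] [Field L] [Algebra k L] [CommRing B]
    [Algebra k B] (z : L ⊗[k] B) : ∃ s : Finset L, ∀ L₀ : IntermediateField k L, (s : Set L) ⊆ L₀ →
      z ∈ (Algebra.TensorProduct.map L₀.val (AlgHom.id k B)).range := by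
  classical
  induction z with
  | zero => exact ⟨∅, fun L₀ _ => zero_mem _⟩
  | add x y hx hy =>
    obtain ⟨s, hs⟩ := hx
    obtain ⟨t, ht⟩ := hy
    refine ⟨s ∪ t, fun L₀ h => ?_⟩
    rw [Finset.coe_union, Set.union_subset_iff] at h
    exact add_mem (hs L₀ h.1) (ht L₀ h.2)
  | tmul l b =>
    refine ⟨{l}, fun L₀ h => ⟨(⟨l, h (by simp)⟩ : L₀) ⊗ₜ b, by simp⟩⟩

/-- An element and its integral equation involve only finitely many elements of `L`, so both descend
to a finitely generated subextension `L₀`; the equation still holds there because `L₀ ⊗ B → L ⊗ B`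
is injective. -/
theorem PreservesIntClosed.of_perfectField (k L : Type*) [Field k] [PerfectField k] [Field L]
    [Algebra k L] : PreservesIntClosed k L := by
  classical
  intro R B _ _ _ _ f hf z hz
  obtain ⟨p, hp, hpz⟩ := hz
  choose s hs using fun n => exists_finset_mem_range_map (p.coeff n)
  obtain ⟨t, ht⟩ := exists_finset_mem_range_map z
  let u := t ∪ p.support.biUnion s
  let L₀ := IntermediateField.adjoin k (u : Set L)
  have hu : (u : Set L) ⊆ L₀ := IntermediateField.subset_adjoin _ _
  have : Algebra.EssFiniteType k L₀ :=
    IntermediateField.essFiniteType_iff.mpr (IntermediateField.fg_adjoin_finset u)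
  have hlift : p ∈ Polynomial.lifts
      (Algebra.TensorProduct.map L₀.val (AlgHom.id k R)).toRingHom := by
    rw [Polynomial.lifts_iff_coeff_lifts]
    intro n
    by_cases hn : n ∈ p.support
    · refine hs n L₀ (subset_trans ?_ hu)
      exact_mod_cast (Finset.subset_biUnion_of_mem s hn).trans Finset.subset_union_right
    · rw [Polynomial.notMem_support_iff.mp hn]; exact ⟨0, map_zero _⟩
  obtain ⟨q, hqp, -, hq⟩ := Polynomial.lifts_and_natDegree_eq_and_monic hlift hp
  obtain ⟨z', hz'⟩ := ht L₀ (subset_trans (by exact_mod_cast Finset.subset_union_left) hu)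
  have hinj : Function.Injective (Algebra.TensorProduct.map L₀.val (AlgHom.id k B)) :=
    Module.Flat.rTensor_preserves_injective_linearMap L₀.val.toLinearMap L₀.val.injective
  have comm : (Algebra.TensorProduct.map (AlgHom.id k L) f).toRingHom.comp
      (Algebra.TensorProduct.map L₀.val (AlgHom.id k R)).toRingHom =
      (Algebra.TensorProduct.map L₀.val (AlgHom.id k B)).toRingHom.comp
      (Algebra.TensorProduct.map (AlgHom.id k L₀) f).toRingHom := by
    ext <;> simp
  obtain ⟨y, hy⟩ := PreservesIntClosed.of_essFiniteType k L₀ R B f hf z' ⟨q, hq, hinj (by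
    rw [map_zero]
    rw [← hqp, ← hz', Polynomial.eval₂_map, comm] at hpz
    exact (Polynomial.hom_eval₂ q _ _ z').trans hpz)⟩
  exact ⟨_, (RingHom.congr_fun comm y).trans ((congrArg _ hy).trans hz')⟩

end IntegrallyClosedBaseChange

/-! ### Geometrically irreducible extensions of perfect fields -/

section GeometricallyIrreducible

theorem RingHom.IsIntClosed.comp {R S T : Type*} [CommRing R] [CommRing S] [CommRing T]
    {f : R →+* S} {g : S →+* T} (hg : g.IsIntClosed) (hf : f.IsIntClosed)
    (hinj : Function.Injective g) : (g.comp f).IsIntClosed := by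
  rintro b ⟨p, hp, hpb⟩
  obtain ⟨s, rfl⟩ := hg b ⟨p.map f, hp.map f, by rwa [Polynomial.eval₂_map]⟩
  obtain ⟨r, rfl⟩ := hf s ⟨p, hp, hinj (by rw [Polynomial.hom_eval₂, hpb, map_zero])⟩
  exact ⟨r, rfl⟩

theorem RingHom.IsIntClosed.isIntegrallyClosed {S E : Type*} [CommRing S] [IsDomain S] [Field E]
    {f : S →+* E} (hf : f.IsIntClosed) (hinj : Function.Injective f) : IsIntegrallyClosed S := by
  rw [isIntegrallyClosed_iff (FractionRing S)]
  intro x hx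
  let g : FractionRing S →+* E := IsFractionRing.lift hinj
  have hg : g.comp (algebraMap S (FractionRing S)) = f.comp (RingHom.id S) :=
    IsLocalization.lift_comp _
  obtain ⟨s, hs⟩ := hf _ (RingHom.IsIntegralElem.map_of_comp_eq _ g hg hx)
  exact ⟨s, g.injective ((RingHom.congr_fun hg s).trans hs)⟩

theorem IsIntegrallyClosed.isIntClosed_algebraMap (R K : Type*) [CommRing R] [IsDomain R]
    [IsIntegrallyClosed R] [Field K] [Algebra R K] [IsFractionRing R K] :
    (algebraMap R K).IsIntClosed :=
  fun _ hb => IsIntegrallyClosed.isIntegral_iff.mp hb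

/-- The descending powers of `x` give `x ^ n = x ^ (n + 1) * y`, and reducedness cancels this to `x
= x * (x * y)`. So `x * y` is idempotent, and it cannot vanish unless `x` does. -/
theorem isField_of_isReduced_of_isArtinianRing {E : Type*} [CommRing E] [Nontrivial E]
    [IsReduced E] [IsArtinianRing E] (h : ∀ e : E, IsIdempotentElem e → e = 0 ∨ e = 1) :
    IsField E := by
  refine ⟨exists_pair_ne E, mul_comm, fun {x} hx => ?_⟩
  obtain ⟨n, y, hy⟩ := IsArtinian.exists_pow_succ_smul_dvd x (1 : E)
  simp only [smul_eq_mul, mul_one] at hy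
  have h0 : x * (1 - x * y) = 0 := by
    refine eq_zero_of_pow_eq_zero (n := n + 1) ?_
    rw [mul_pow, pow_succ (1 - x * y), pow_succ x]
    have : x ^ n * (1 - x * y) = 0 := by rw [mul_sub, ← mul_assoc, ← pow_succ, hy]; ring
    linear_combination x * (1 - x * y) ^ n * this
  obtain h1 | h1 := h (x * y) (by unfold IsIdempotentElem; linear_combination (-y) * h0)
  · exact absurd (by rwa [h1, sub_zero, mul_one] at h0) hx
  · exact ⟨y, h1⟩

theorem IsIdempotentElem.isIntegralElem {R B : Type*} [CommRing R] [CommRing B] (f : R →+* B)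
    {e : B} (he : IsIdempotentElem e) : f.IsIntegralElem e := by
  cases subsingleton_or_nontrivial R
  · exact ⟨0, Subsingleton.elim _ _, Polynomial.eval₂_zero _ _⟩
  refine ⟨Polynomial.X ^ 2 - Polynomial.X,
    (Polynomial.monic_X_pow 2).sub_of_left (by simp), ?_⟩
  rw [Polynomial.eval₂_sub, Polynomial.eval₂_X_pow, Polynomial.eval₂_X, pow_two, he.eq, sub_self]

/-- An idempotent is integral over any base. As `k` is integrally closed in `Q`, the ring `L ⊗ k` is
so in `L ⊗ Q`, and the idempotent already lives in a copy of the field `L`. -/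
theorem isIdempotentElem_tensorProduct {k L Q : Type*} [Field k] [PerfectField k] [Field L]
    [Algebra k L] [Field Q] [Algebra k Q] (hk : (algebraMap k Q).IsIntClosed) (e : L ⊗[k] Q)
    (he : IsIdempotentElem e) : e = 0 ∨ e = 1 := by
  obtain ⟨y, rfl⟩ := PreservesIntClosed.of_perfectField k L k Q (Algebra.ofId k Q) hk e
    (he.isIntegralElem _)
  have hinj : Function.Injective (Algebra.TensorProduct.map (AlgHom.id k L) (Algebra.ofId k Q)) :=
    Module.Flat.lTensor_preserves_injective_linearMap (Algebra.ofId k Q).toLinearMap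
      (algebraMap k Q).injective
  have hy : IsIdempotentElem y := hinj (by rw [map_mul]; exact he)
  have : IsDomain (L ⊗[k] k) := (Algebra.TensorProduct.rid k k L).toMulEquiv.isDomain
  obtain h | h := IsIdempotentElem.iff_eq_zero_or_one.mp hy
  · exact .inl (by rw [h]; exact map_zero _)
  · exact .inr (by rw [h]; exact map_one _)

/-- `K ⊗ L` is the localization of the normal domain `R ⊗ L` at the nonzero elements of `R`. -/
theorem isDomain_and_isIntegrallyClosed_of_isFractionRing (k L R K : Type*) [Field k] [CommRing L]
    [Algebra k L] [CommRing R] [IsDomain R] [Algebra k R] [Field K] [Algebra k K] [Algebra R K]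
    [IsScalarTower k R K] [IsFractionRing R K] [IsDomain (R ⊗[k] L)]
    [IsIntegrallyClosed (R ⊗[k] L)] :
    IsDomain (K ⊗[k] L) ∧ IsIntegrallyClosed (K ⊗[k] L) := by
  have : Nontrivial L :=
    (Algebra.TensorProduct.includeRight : L →ₐ[k] R ⊗[k] L).toRingHom.domain_nontrivial
  let M := Algebra.algebraMapSubmonoid (R ⊗[k] L) (nonZeroDivisors R)
  have hM : M ≤ nonZeroDivisors (R ⊗[k] L) := by
    rintro _ ⟨x, hx, rfl⟩
    refine mem_nonZeroDivisors_of_ne_zero fun h => nonZeroDivisors.ne_zero hx ?_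
    exact (FaithfulSMul.algebraMap_injective R (R ⊗[k] L)) (h.trans (map_zero _).symm)
  have h0 : IsLocalization M ((R ⊗[k] L) ⊗[R] K) := IsLocalization.tensor K (nonZeroDivisors R)
  have h3 : IsDomain ((R ⊗[k] L) ⊗[R] K) :=
    IsLocalization.isDomain_of_le_nonZeroDivisors _ hM
  have h4 : IsIntegrallyClosed ((R ⊗[k] L) ⊗[R] K) :=
    isIntegrallyClosed_of_isLocalization _ M hM
  let e : (R ⊗[k] L) ⊗[R] K ≃+* K ⊗[k] L :=
    (Algebra.TensorProduct.comm R _ _).toRingEquiv.trans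
      (Algebra.TensorProduct.cancelBaseChange k R K K L).toRingEquiv
  exact ⟨e.symm.toMulEquiv.isDomain, .of_equiv (R := (R ⊗[k] L) ⊗[R] K) e⟩

open scoped IntermediateField.algebraAdjoinAdjoin in
theorem isDomain_and_isIntegrallyClosed_adjoin_tensorProduct {k L Q : Type*} [Field k] [Field L]
    [Algebra k L] [Field Q] [Algebra k Q] {s : Set Q}
    (hs : AlgebraicIndependent k ((↑) : s → Q)) :
    IsDomain (IntermediateField.adjoin k s ⊗[k] L) ∧
      IsIntegrallyClosed (IntermediateField.adjoin k s ⊗[k] L) := by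
  have e := hs.aevalEquiv
  rw [Subtype.range_coe_subtype, Set.ofPred_mem_eq] at e
  let e' : MvPolynomial s L ≃+* Algebra.adjoin k s ⊗[k] L :=
    ((MvPolynomial.algebraTensorAlgEquiv k L).symm.toRingEquiv.trans
      (Algebra.TensorProduct.comm k L _).toRingEquiv).trans
        (Algebra.TensorProduct.congr e AlgEquiv.refl).toRingEquiv
  have h1 : IsDomain (Algebra.adjoin k s ⊗[k] L) := e'.symm.toMulEquiv.isDomain
  have h2 : IsIntegrallyClosed (Algebra.adjoin k s ⊗[k] L) := .of_equiv e'
  exact isDomain_and_isIntegrallyClosed_of_isFractionRing k L (Algebra.adjoin k s) _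

/-- With `F` the fraction field of `N`, the ring `Q ⊗ F` is finite étale over `F`, hence reduced and
Artinian. Since `Q` is smooth over `K`, the ring `Q ⊗ N` is integrally closed in `Q ⊗ F`, so
idempotents of the latter come from the former and are trivial. Thus `Q ⊗ F` is a field, and a ring
integrally closed in a field is a normal domain. -/
theorem isDomain_and_isIntegrallyClosed_of_isIdempotentElem {K Q N : Type*} [Field K] [Field Q]
    [Algebra K Q] [Module.Finite K Q] [Algebra.IsSeparable K Q] [CommRing N] [IsDomain N]
    [IsIntegrallyClosed N] [Algebra K N]
    {S : Type*} [CommRing S] (e : Q ⊗[K] N ≃+* S)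
    (h : ∀ y : S, IsIdempotentElem y → y = 0 ∨ y = 1) :
    IsDomain S ∧ IsIntegrallyClosed S := by
  have : Algebra.FormallyEtale K Q := .of_isSeparable _ Q
  have : Algebra.Smooth K Q := ⟨inferInstance,
    Algebra.FinitePresentation.of_finiteType.mp inferInstance⟩
  let F := FractionRing N
  let f := Algebra.TensorProduct.map (AlgHom.id K Q) (IsScalarTower.toAlgHom K N F)
  have hf : f.toRingHom.IsIntClosed := PreservesIntClosed.of_smooth K Q N F _
    (IsIntegrallyClosed.isIntClosed_algebraMap N F)
  have hinj : Function.Injective f :=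
    Module.Flat.lTensor_preserves_injective_linearMap (M := Q)
      (IsScalarTower.toAlgHom K N F).toLinearMap (IsFractionRing.injective N F)
  have : IsReduced (F ⊗[K] Q) := Algebra.FormallyUnramified.isReduced_of_field F _
  have : IsArtinianRing (F ⊗[K] Q) := IsArtinianRing.of_finite F _
  have hE : IsField (Q ⊗[K] F) := by
    refine (Algebra.TensorProduct.comm K Q F).toMulEquiv.isField
      (isField_of_isReduced_of_isArtinianRing fun x hx => ?_)
    obtain ⟨x, rfl⟩ := (Algebra.TensorProduct.comm K Q F).surjective x
    replace hx : IsIdempotentElem x :=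
      (Algebra.TensorProduct.comm K Q F).injective (by rw [map_mul]; exact hx)
    obtain ⟨y, rfl⟩ := hf x (hx.isIntegralElem _)
    have hy : IsIdempotentElem y := hinj (by rw [map_mul]; exact hx)
    have hey : IsIdempotentElem (e y) := by
      unfold IsIdempotentElem; rw [← map_mul, hy.eq]
    obtain h | h := h (e y) hey
    · left; rw [(map_eq_zero_iff e e.injective).mp h]; simp
    · right; rw [(map_eq_one_iff e e.injective).mp h]; simp
  let _ : Field (Q ⊗[K] F) := hE.toField
  have h3 : IsDomain (Q ⊗[K] N) := hinj.isDomain f.toRingHom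
  have h4 : IsIntegrallyClosed (Q ⊗[K] N) := hf.isIntegrallyClosed hinj
  exact ⟨e.symm.toMulEquiv.isDomain, .of_equiv e⟩

theorem isDomain_and_isIntegrallyClosed_tensorProduct_of_isSeparable {k L K Q : Type*} [Field k]
    [PerfectField k] [Field L] [Algebra k L] [Field K] [Algebra k K] [Field Q] [Algebra k Q]
    [Algebra K Q] [IsScalarTower k K Q] [Module.Finite K Q] [Algebra.IsSeparable K Q]
    (hk : (algebraMap k Q).IsIntClosed) [IsDomain (K ⊗[k] L)] [IsIntegrallyClosed (K ⊗[k] L)] :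
    IsDomain (L ⊗[k] Q) ∧ IsIntegrallyClosed (L ⊗[k] Q) :=
  isDomain_and_isIntegrallyClosed_of_isIdempotentElem
    ((Algebra.TensorProduct.cancelBaseChange k K Q Q L).toRingEquiv.trans
      (Algebra.TensorProduct.comm k Q L).toRingEquiv) (isIdempotentElem_tensorProduct hk)

theorem isDomain_and_isIntegrallyClosed_tensorProduct {k L Q : Type*} [Field k] [PerfectField k]
    [Field L] [Algebra k L] [Field Q] [Algebra k Q] [Algebra.EssFiniteType k Q]
    (hk : (algebraMap k Q).IsIntClosed) :
    IsDomain (L ⊗[k] Q) ∧ IsIntegrallyClosed (L ⊗[k] Q) := by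
  obtain ⟨s, hs, H⟩ := exists_isTranscendenceBasis_and_isSeparable_of_perfectField k Q
  obtain ⟨h1, h2⟩ := isDomain_and_isIntegrallyClosed_adjoin_tensorProduct (L := L)
    (s := (s : Set Q)) hs.1
  have : Algebra.EssFiniteType (IntermediateField.adjoin k (s : Set Q)) Q := .of_comp k _ _
  have : Algebra.FormallyEtale (IntermediateField.adjoin k (s : Set Q)) Q := .of_isSeparable _ Q
  have : Module.Finite (IntermediateField.adjoin k (s : Set Q)) Q :=
    Algebra.FormallyUnramified.finite_of_free _ _
  exact isDomain_and_isIntegrallyClosed_tensorProduct_of_isSeparable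
    (K := IntermediateField.adjoin k (s : Set Q)) hk

theorem isIntegrallyClosed_tensorProduct {k L A Q : Type*} [Field k] [PerfectField k]
    [Field L] [Algebra k L] [Field Q] [Algebra k Q] [Algebra.EssFiniteType k Q]
    (hk : (algebraMap k Q).IsIntClosed) [CommRing A] [Algebra k A] (f : A →ₐ[k] Q)
    (hf : f.toRingHom.IsIntClosed) (hinj : Function.Injective f) :
    IsDomain (L ⊗[k] A) ∧ IsIntegrallyClosed (L ⊗[k] A) := by
  obtain ⟨h1, h2⟩ := isDomain_and_isIntegrallyClosed_tensorProduct (L := L) hk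
  let g := Algebra.TensorProduct.map (AlgHom.id k L) f
  have hg : Function.Injective g :=
    Module.Flat.lTensor_preserves_injective_linearMap f.toLinearMap hinj
  have : IsDomain (L ⊗[k] A) := hg.isDomain g.toRingHom
  have hF := IsFractionRing.injective (L ⊗[k] Q) (FractionRing (L ⊗[k] Q))
  refine ⟨this, ((IsIntegrallyClosed.isIntClosed_algebraMap (L ⊗[k] Q)
    (FractionRing (L ⊗[k] Q))).comp (PreservesIntClosed.of_perfectField k L A Q f hf)
      hF).isIntegrallyClosed (hF.comp hg)⟩

end GeometricallyIrreducible

/-! ### Finiteness of integral closures and the ring `A_L` -/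

section RingAway

theorem isNoetherian_of_injective_semilinear {R D C : Type*} [CommRing R] [IsNoetherianRing R]
    [CommRing D] [AddCommGroup C] [Module R C] {g : R →+* D} (hg : g.Finite) (φ : C →+ D)
    (hφ : Function.Injective φ) (h : ∀ (r : R) (c : C), φ (r • c) = g r * φ c) :
    IsNoetherian R C := by
  algebraize [g]
  have : Module.Finite R D := hg
  exact isNoetherian_of_injective
    ({ toFun := φ, map_add' := map_add φ, map_smul' := fun r c => by
        rw [h, RingHom.id_apply, Algebra.smul_def]; rfl } : C →ₗ[R] D)
    hφ

theorem RingHom.Finite.iterateFrobenius {R : Type*} [CommRing R] (p : ℕ) [ExpChar R p]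
    (h : (frobenius R p).Finite) (n : ℕ) : (_root_.iterateFrobenius R p n).Finite := by
  induction n with
  | zero => rw [iterateFrobenius_zero]; exact RingHom.Finite.id R
  | succ n ih =>
    have : _root_.iterateFrobenius R p (n + 1) =
        (_root_.iterateFrobenius R p n).comp (frobenius R p) := by
      ext x
      simp [iterateFrobenius_def, frobenius_def, pow_succ', pow_mul]
    rw [this]
    exact ih.comp h

/-- Over a Noetherian normal domain with finite Frobenius the integral closure in any finite
extension of the fraction field is finite. -/
theorem isNoetherian_integralClosure_of_finite_frobenius (R K Q : Type*) [CommRing R] [IsDomain R]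
    [IsNoetherianRing R] [IsIntegrallyClosed R] [Field K] [Algebra R K] [IsFractionRing R K]
    [Field Q] [Algebra R Q] [Algebra K Q] [IsScalarTower R K Q] [FiniteDimensional K Q]
    (p : ℕ) [ExpChar R p] (h : (frobenius R p).Finite) :
    IsNoetherian R (integralClosure R Q) := by
  have : ExpChar K p := expChar_of_injective_algebraMap (IsFractionRing.injective R K) p
  have : ExpChar Q p := expChar_of_injective_algebraMap (algebraMap K Q).injective p
  let S := separableClosure K Q
  have : ExpChar S p := expChar_of_injective_algebraMap (algebraMap K S).injective p
  have : IsScalarTower R S Q := .of_algebraMap_eq fun r => by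
    rw [IsScalarTower.algebraMap_apply R K Q, IsScalarTower.algebraMap_apply R K S]; rfl
  let n := IsPurelyInseparable.exponent S Q
  have hn : ∀ a : Q, a ^ p ^ n ∈ S := fun a => by
    obtain ⟨s, hs⟩ := IsPurelyInseparable.exponent_def' S p a
    rw [← hs]; exact s.2
  have : Module.Finite R (integralClosure R S) := IsIntegralClosure.finite R K S _
  have hint : ∀ (c : integralClosure R Q), (⟨(c : Q) ^ p ^ n, hn c⟩ : S) ∈ integralClosure R S :=
    fun c => by
      have := (c.2 : IsIntegral R (c : Q)).pow (p ^ n)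
      exact (isIntegral_algHom_iff (IsScalarTower.toAlgHom R S Q)
        (algebraMap S Q).injective).mp this
  -- The `p ^ n`-th power map sends the integral closure in `Q` injectively into the one in `S`,
  -- semilinearly over the `n`-th iterate of Frobenius. The target is finite over `R` because `S /
  -- K` is separable, and it stays finite after twisting by Frobenius.
  refine isNoetherian_of_injective_semilinear (D := integralClosure R S)
    (g := (algebraMap R (integralClosure R S)).comp (iterateFrobenius R p n))
    (RingHom.Finite.comp (RingHom.finite_algebraMap.mpr this)
      (RingHom.Finite.iterateFrobenius p h n))
    { toFun := fun c => ⟨⟨(c : Q) ^ p ^ n, hn c⟩, hint c⟩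
      map_zero' := by ext; simp [(expChar_pos K p).ne']
      map_add' := fun a b => by ext; simp [add_pow_expChar_pow] } ?_ ?_
  · intro a b hab
    have : (a : Q) ^ p ^ n = (b : Q) ^ p ^ n :=
      congrArg (fun x : integralClosure R S => ((x : S) : Q)) hab
    exact Subtype.ext (iterateFrobenius_inj Q p n this)
  · intro r c
    ext
    change (((r • c : integralClosure R Q) : Q)) ^ p ^ n =
      algebraMap R Q (iterateFrobenius R p n r) * (c : Q) ^ p ^ n
    rw [iterateFrobenius_def, map_pow, ← mul_pow, ← Algebra.smul_def]
    rfl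

/-- Integrality is clear, as `x` is a root of `X ^ p - x`. Perfectness gives finite type: all
constants are `p`-th powers, so only the variable has to be adjoined. -/
theorem finite_frobenius_polynomial (k : Type*) [Field k] (p : ℕ) [ExpChar k p] [PerfectRing k p] :
    (frobenius (Polynomial k) p).Finite := by
  refine RingHom.IsIntegral.to_finite (fun x => ?_) ?_
  · refine ⟨Polynomial.X ^ p - Polynomial.C x,
      Polynomial.monic_X_pow_sub_C x (expChar_pos k p).ne', ?_⟩
    rw [Polynomial.eval₂_sub, Polynomial.eval₂_X_pow, Polynomial.eval₂_C, frobenius_def, sub_self]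
  · refine RingHom.FiniteType.of_comp_finiteType (f := Polynomial.C) ?_
    have : (frobenius (Polynomial k) p).comp Polynomial.C =
        Polynomial.C.comp (frobenius k p) := by
      ext x : 1; simp [frobenius_def]
    rw [this]
    refine RingHom.FiniteType.comp ?_ (RingHom.FiniteType.of_surjective _ (surjective_frobenius k p))
    exact (RingHom.finiteType_algebraMap (A := k) (B := Polynomial k)).mpr inferInstance

/-- Domains which are finite over a polynomial ring in one variable. -/
theorem finite_quotient_of_finite_over_polynomial {L D : Type*} [Field L] [CommRing D] [IsDomain D]
    [Algebra L D] (g : Polynomial L →ₐ[L] D) (hg : g.toRingHom.Finite) :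
    IsNoetherianRing D ∧ Ring.DimensionLEOne D ∧
      ∀ I : Ideal D, I ≠ ⊥ → Module.Finite L (D ⧸ I) := by
  algebraize [g.toRingHom]
  have : Module.Finite (Polynomial L) D := hg
  refine ⟨isNoetherianRing_iff.mpr (isNoetherian_of_tower (Polynomial L) inferInstance),
    Ring.DimensionLEOne.of_isIntegral (Polynomial L) D, fun I hI => ?_⟩
  -- By integrality `I` meets the polynomial ring in some `p ≠ 0`, and `D / I` is finite over the
  -- finite-dimensional algebra `L[X] / (p)`.
  obtain ⟨p, hp, hp0⟩ := Submodule.exists_mem_ne_zero_of_ne_bot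
    (Ideal.IsIntegral.comap_ne_bot (R := Polynomial L) hI)
  have h1 : Module.Finite L (AdjoinRoot p) := (AdjoinRoot.powerBasis hp0).finite
  let h : AdjoinRoot p →ₐ[L] D ⧸ I := Ideal.Quotient.liftₐ _ ((Ideal.Quotient.mkₐ L I).comp g)
    fun x hx => by
      obtain ⟨y, rfl⟩ := Ideal.mem_span_singleton'.mp hx
      exact Ideal.Quotient.eq_zero_iff_mem.mpr (by rw [map_mul]; exact I.mul_mem_left _ hp)
  have h2 : h.toRingHom.Finite := by
    refine RingHom.Finite.of_comp_finite (f := AdjoinRoot.mk p) ?_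
    have : h.toRingHom.comp (AdjoinRoot.mk p) = (Ideal.Quotient.mk I).comp g.toRingHom := by
      ext <;> rfl
    rw [this]
    exact (RingHom.Finite.of_surjective _ Ideal.Quotient.mk_surjective).comp hg
  rw [← RingHom.finite_algebraMap] at h1 ⊢
  rw [← h.comp_algebraMap]
  exact h2.comp h1

end RingAway

/-! ### The function field: `A` is finite over a polynomial ring, and `A_L` is a Dedekind domain -/

section RingAway

variable {Fq Q : Type*} [Field Fq] [Field Q] [Algebra Fq Q]

theorem IsCurveFunctionField.essFiniteType (hQ : IsCurveFunctionField Fq Q) :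
    Algebra.EssFiniteType Fq Q := by
  obtain ⟨x, -, hx⟩ := hQ.exists_finite
  have : Algebra.EssFiniteType Fq (IntermediateField.adjoin Fq {x}) :=
    IntermediateField.essFiniteType_iff.mpr
      (IntermediateField.fg_adjoin_of_finite (Set.finite_singleton x))
  exact .comp Fq (IntermediateField.adjoin Fq {x}) Q

theorem IsCurveFunctionField.isIntClosed (hQ : IsCurveFunctionField Fq Q) :
    (algebraMap Fq Q).IsIntClosed :=
  fun b hb => hQ.constants b (IsIntegral.isAlgebraic (R := Fq) hb)

/-- The function field is algebraic over the polynomials in any transcendental element. -/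
theorem IsCurveFunctionField.isAlgebraic_adjoin (hQ : IsCurveFunctionField Fq Q) {x : Q}
    (hx : Transcendental Fq x) : Algebra.IsAlgebraic (Algebra.adjoin Fq {x}) Q := by
  obtain ⟨y, hy, hfin⟩ := hQ.exists_finite
  have hy' : AlgebraicIndependent Fq (fun _ : Unit => y) :=
    algebraicIndependent_unique_type_iff.mpr hy
  have hx' : AlgebraicIndependent Fq (fun _ : Unit => x) :=
    algebraicIndependent_unique_type_iff.mpr hx
  have halg : Algebra.IsAlgebraic (Algebra.adjoin Fq (Set.range fun _ : Unit => y)) Q := by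
    rw [Set.range_const]
    have := Algebra.IsAlgebraic.of_finite (IntermediateField.adjoin Fq {y}) Q
    exact IntermediateField.isAlgebraic_adjoin_iff_top.mp this
  have hb : IsTranscendenceBasis Fq (fun _ : Unit => y) :=
    hy'.isTranscendenceBasis_iff_isAlgebraic.mpr halg
  -- The transcendence degree is one, so any single transcendental element is already a
  -- transcendence basis.
  have hle : Cardinal.lift.{0} (Algebra.trdeg Fq Q) ≤ Cardinal.lift (Cardinal.mk Unit) :=
    hb.lift_cardinalMk_eq_trdeg.ge
  have hbx := hx'.isTranscendenceBasis_of_lift_trdeg_le_of_finite hle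
  have := hbx.isAlgebraic
  rwa [Set.range_const] at this

namespace RationalPoint

variable (P : RationalPoint Fq Q)

/-- An intersection of valuation rings is integrally closed, because each of them is. -/
theorem isIntClosed_ringAway : P.ringAway.val.toRingHom.IsIntClosed := by
  intro z hz
  refine ⟨⟨z, fun v h₁ h₂ h₃ => ?_⟩, rfl⟩
  let g : P.ringAway →+* v :=
    { toFun := fun a => ⟨a, a.2 v h₁ h₂ h₃⟩
      map_one' := rfl
      map_mul' := fun _ _ => rfl
      map_zero' := rfl
      map_add' := fun _ _ => rfl }
  have hv : IsIntegral v z := RingHom.IsIntegralElem.map_of_comp_eq (f' := algebraMap v Q) g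
    (RingHom.id Q) rfl hz
  obtain ⟨y, rfl⟩ := IsIntegrallyClosed.isIntegral_iff.mp hv
  exact y.2

/-- The integral closure is the intersection of the valuation rings above `S`; one that omits `z`
cannot be all of `Q`. -/
theorem exists_valuationSubring_notMem {S : Subalgebra Fq Q} {z : Q} (hz : ¬ IsIntegral S z) :
    ∃ v : ValuationSubring Q, v ≠ ⊤ ∧ (S : Set Q) ⊆ v ∧ z ∉ v := by
  have hmem : z ∉ (integralClosure (Subring.closure (S : Set Q)) Q).toSubring := by
    intro h
    refine hz (RingHom.IsIntegralElem.map_of_comp_eq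
      (f := algebraMap (Subring.closure (S : Set Q)) Q) (f' := algebraMap S Q)
      (Subring.inclusion (Subring.closure_le.mpr subset_rfl : _ ≤ S.toSubring)) (RingHom.id Q) rfl h)
  rw [← iInf_valuationSubring_superset, Subring.mem_iInf] at hmem
  push Not at hmem
  obtain ⟨⟨v, hv⟩, hzv⟩ := hmem
  exact ⟨v, fun h => hzv (by subst h; exact ValuationSubring.mem_top _), hv, hzv⟩

/-- If the ring `A` contains a transcendental element `x`, it is integral over the polynomials in
`x`. -/
theorem isIntegral_adjoin_of_mem_ringAway {x : Q}
    (hx : x ∈ P.ringAway) (hxt : Transcendental Fq x) {a : Q} (ha : a ∈ P.ringAway) :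
    IsIntegral (Algebra.adjoin Fq {x}) a := by
  have hmem : ∀ {v : ValuationSubring Q} {S : Subalgebra Fq Q}, (S : Set Q) ⊆ v →
      ∀ a : Fq, algebraMap Fq Q a ∈ v := fun h a => h (Subalgebra.algebraMap_mem _ a)
  by_contra h
  obtain ⟨v, hv, hle, hav⟩ := exists_valuationSubring_notMem h
  -- Only the valuation ring at `∞` can omit an element of `A`. As `v` contains `x`, the function
  -- `x` is regular at `∞` too.
  have hvP : v = P.localRing := by
    by_contra hne
    exact hav (ha v hv (hmem hle) hne)
  have hint : ¬ IsIntegral (⊥ : Subalgebra Fq Q) x := fun hi => by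
    refine hxt (IsIntegral.isAlgebraic (R := Fq) ?_)
    exact RingHom.IsIntegralElem.map_of_comp_eq (f' := algebraMap Fq Q)
      (Algebra.botEquiv Fq Q).toRingEquiv.toRingHom (RingHom.id Q) (by
        ext y
        obtain ⟨r, rfl⟩ := (Algebra.botEquiv Fq Q).symm.surjective y
        simp) hi
  -- Not being integral over the constants, `x` has a pole somewhere. This must be at `∞`, where it
  -- has just been excluded.
  obtain ⟨w, hw, hwle, hxw⟩ := exists_valuationSubring_notMem hint
  refine hxw (hx w hw (hmem hwle) fun hwP => hxw ?_)
  rw [hwP, ← hvP]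
  exact hle (Algebra.self_mem_adjoin_singleton Fq x)

end RationalPoint

/-- If the ring `A` contains a transcendental element `x`, it is a finite module over the polynomial
ring in `x`. -/
theorem RationalPoint.finite_aeval_ringAway (P : RationalPoint Fq Q) [Finite Fq]
    (hQ : IsCurveFunctionField Fq Q) {x : P.ringAway} (hx : Transcendental Fq (x : Q)) :
    (Polynomial.aeval (R := Fq) x).toRingHom.Finite := by
  obtain ⟨p, hp⟩ := ExpChar.exists Fq
  have := hQ.essFiniteType
  let _ : Algebra (Polynomial Fq) Q := (Polynomial.aeval (R := Fq) (x : Q)).toRingHom.toAlgebra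
  have hinj : Function.Injective (algebraMap (Polynomial Fq) Q) :=
    transcendental_iff_injective.mp hx
  have : FaithfulSMul (Polynomial Fq) Q := (faithfulSMul_iff_algebraMap_injective _ _).mpr hinj
  have : IsScalarTower Fq (Polynomial Fq) Q :=
    .of_algebraMap_eq fun r => (Polynomial.aeval_C (x : Q) r).symm
  let K := FractionRing (Polynomial Fq)
  let _ : Algebra K Q := FractionRing.liftAlgebra (Polynomial Fq) Q
  have : IsScalarTower (Polynomial Fq) K Q := FractionRing.isScalarTower_liftAlgebra _ _
  have : IsScalarTower Fq K Q := .to₁₃₄ Fq (Polynomial Fq) K Q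
  have : Algebra.EssFiniteType K Q := .of_comp Fq K Q
  let f : Polynomial Fq →ₐ[Fq] Algebra.adjoin Fq {(x : Q)} :=
    Polynomial.aeval ⟨(x : Q), Algebra.self_mem_adjoin_singleton Fq _⟩
  have hcomp : (algebraMap (Algebra.adjoin Fq {(x : Q)}) Q).comp f.toRingHom =
      (RingHom.id Q).comp (algebraMap (Polynomial Fq) Q) := by
    have : (Algebra.adjoin Fq {(x : Q)}).val.comp f = Polynomial.aeval (x : Q) := by
      ext; simp [f]
    exact congrArg AlgHom.toRingHom this
  have hsurj : Function.Surjective f := by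
    rintro ⟨y, hy⟩
    rw [Algebra.adjoin_singleton_eq_range_aeval] at hy
    obtain ⟨q, rfl⟩ := hy
    exact ⟨q, Subtype.ext (RingHom.congr_fun hcomp q)⟩
  have hfinj : Function.Injective f := by
    have : Function.Injective ((algebraMap (Algebra.adjoin Fq {(x : Q)}) Q).comp f.toRingHom) := by
      rw [hcomp]; exact hinj
    exact Function.Injective.of_comp (f := algebraMap (Algebra.adjoin Fq {(x : Q)}) Q) this
  have halg : Algebra.IsAlgebraic (Polynomial Fq) Q := by
    have := hQ.isAlgebraic_adjoin hx
    exact ⟨fun y => (Algebra.IsAlgebraic.isAlgebraic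
      (R := Algebra.adjoin Fq {(x : Q)}) y).of_ringHom_of_comp_eq
        f.toRingHom (RingHom.id Q) hsurj Function.injective_id hcomp⟩
  have : Algebra.IsAlgebraic K Q := .extendScalars (IsFractionRing.injective (Polynomial Fq) K)
  have : FiniteDimensional K Q := Algebra.finite_of_essFiniteType_of_isAlgebraic
  have : ExpChar (Polynomial Fq) p :=
    expChar_of_injective_algebraMap (Polynomial.C_injective (R := Fq)) p
  -- `A` lies in the integral closure of the polynomial ring in `Q`, so Noetherianity of the latter
  -- makes `A` finite.
  have hN := isNoetherian_integralClosure_of_finite_frobenius (Polynomial Fq) K Q p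
    (finite_frobenius_polynomial Fq p)
  have hmem : ∀ a : P.ringAway, IsIntegral (Polynomial Fq) (a : Q) := fun a => by
    refine RingHom.IsIntegralElem.map_of_comp_eq (f' := algebraMap (Polynomial Fq) Q)
      (AlgEquiv.ofBijective f ⟨hfinj, hsurj⟩).symm.toRingEquiv.toRingHom (RingHom.id Q) ?_
        (P.isIntegral_adjoin_of_mem_ringAway x.2 hx a.2)
    ext y
    obtain ⟨y, rfl⟩ := (AlgEquiv.ofBijective f ⟨hfinj, hsurj⟩).surjective y
    refine (RingHom.congr_fun hcomp y).trans ?_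
    simp
  algebraize [(Polynomial.aeval (R := Fq) x).toRingHom]
  let φ : P.ringAway →ₗ[Polynomial Fq] integralClosure (Polynomial Fq) Q :=
    { toFun := fun a => ⟨a, hmem a⟩
      map_add' := fun _ _ => rfl
      map_smul' := fun r a => by
        ext
        change ((Polynomial.aeval x r * a : P.ringAway) : Q) = r • (a : Q)
        rw [Algebra.smul_def]
        change P.ringAway.val (Polynomial.aeval x r) * (a : Q) =
          Polynomial.aeval (P.ringAway.val x) r * (a : Q)
        rw [Polynomial.aeval_algHom_apply] }
  have := isNoetherian_of_injective φ fun a b hab =>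
    Subtype.ext (congrArg (fun y : integralClosure (Polynomial Fq) Q => (y : Q)) hab)
  change Module.Finite (Polynomial Fq) P.ringAway
  infer_instance

open Polynomial in
theorem finite_baseChange_of_finite_aeval {k L A : Type*} [Field k] [Field L] [Algebra k L]
    [CommRing A] [Algebra k A] (g : k[X] →ₐ[k] A) (hg : g.toRingHom.Finite) :
    ∃ h : L[X] →ₐ[L] L ⊗[k] A, h.toRingHom.Finite := by
  have h1 : (AlgHom.id k L).Finite := RingHom.Finite.id L
  have h2 : g.Finite := hg
  have h3 : (Algebra.TensorProduct.map (AlgHom.id L L) g).toRingHom.Finite :=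
    RingHom.Finite.tensorProductMap h1 h2
  exact ⟨(Algebra.TensorProduct.map (AlgHom.id L L) g).comp (polyEquivTensor' k L).toAlgHom,
    h3.comp (polyEquivTensor' k L).toRingEquiv.finite⟩

/-- The ring `A_L` is a Dedekind domain whose proper quotients are finite-dimensional over `L`. -/
theorem RationalPoint.isDedekindDomain_AL (P : RationalPoint Fq Q) [Finite Fq]
    (hQ : IsCurveFunctionField Fq Q) (L : Type*) [Field L] [Algebra Fq L] :
    IsDedekindDomain (P.AL L) ∧ ∀ I : Ideal (P.AL L), I ≠ ⊥ → Module.Finite L (P.AL L ⧸ I) := by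
  have := hQ.essFiniteType
  obtain ⟨h1, h2⟩ := isIntegrallyClosed_tensorProduct (L := L) hQ.isIntClosed P.ringAway.val
    P.isIntClosed_ringAway Subtype.val_injective
  obtain ⟨g, hg⟩ : ∃ g : Polynomial Fq →ₐ[Fq] P.ringAway, g.toRingHom.Finite := by
    by_cases h : ∃ x : P.ringAway, Transcendental Fq (x : Q)
    · obtain ⟨x, hx⟩ := h
      exact ⟨_, P.finite_aeval_ringAway hQ hx⟩
    -- If `A` had only constants, `X ↦ 0` would be surjective. This makes an appeal to Riemann–Roch
    -- for a nonconstant function superfluous.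
    · refine ⟨Polynomial.aeval 0, RingHom.Finite.of_surjective _ fun a => ?_⟩
      obtain ⟨r, hr⟩ := hQ.constants a (by by_contra ha; exact h ⟨a, ha⟩)
      exact ⟨Polynomial.C r, Subtype.ext (by simpa using hr)⟩
  obtain ⟨g', hg'⟩ := finite_baseChange_of_finite_aeval (L := L) g hg
  obtain ⟨h3, h4, h5⟩ := finite_quotient_of_finite_over_polynomial g' hg'
  exact ⟨{ h1, h3, h4, h2 with }, h5⟩

end RingAway

/-! ### Functoriality of `σ^*` and the associated semilinear maps -/

section FrobeniusPullback

variable {R : Type*} [CommRing R] {σ : R →+* R}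
variable {M N K : Type*} [AddCommGroup M] [Module R M] [AddCommGroup N] [Module R N]
  [AddCommGroup K] [Module R K]

namespace SigmaPullback

theorem hom_ext {f g : SigmaPullback σ M →ₗ[R] N}
    (h : ∀ m, f (tmul σ 1 m) = g (tmul σ 1 m)) : f = g := by
  ext x
  induction x using SigmaPullback.induction_on with
  | zero => rw [map_zero, map_zero]
  | tmul b m =>
    have : tmul σ b m = b • tmul σ 1 m := by rw [smul_tmul, mul_one]
    rw [this, map_smul, map_smul, h]
  | add x y hx hy => rw [map_add, map_add, hx, hy]

theorem coe_map (f : M →ₗ[R] N) :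
    (map σ f : SigmaPullback σ M → SigmaPullback σ N) = f.lTensor (Twist σ) := by
  funext x
  induction x using SigmaPullback.induction_on with
  | zero => rw [map_zero]; exact (map_zero _).symm
  | tmul b m => rw [map_tmul]; rfl
  | add x y hx hy => rw [map_add, hx, hy]; exact (map_add _ _ _).symm

theorem map_injective (hσ : σ.Flat) {f : M →ₗ[R] N} (hf : Function.Injective f) :
    Function.Injective (map σ f) := by
  have : Module.Flat R (Twist σ) := hσ
  rw [coe_map]
  exact Module.Flat.lTensor_preserves_injective_linearMap f hf

theorem map_surjective {f : M →ₗ[R] N} (hf : Function.Surjective f) :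
    Function.Surjective (map σ f) := by
  rw [coe_map]
  exact LinearMap.lTensor_surjective _ hf

theorem map_exact {f : M →ₗ[R] N} {g : N →ₗ[R] K} (h : Function.Exact f g)
    (hg : Function.Surjective g) : Function.Exact (map σ f) (map σ g) := by
  rw [coe_map, coe_map]
  exact lTensor_exact _ h hg

/-- For `b = σ a` one has `b ⊗ m = 1 ⊗ a m`. This is how perfectness of `L` enters the second
factorization. -/
theorem exists_eq_tmul_one (hσ : Function.Surjective σ) (x : SigmaPullback σ M) :
    ∃ m, x = tmul σ 1 m := by
  induction x using SigmaPullback.induction_on with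
  | zero => exact ⟨0, (map_zero (unit σ)).symm⟩
  | tmul b m =>
    obtain ⟨a, rfl⟩ := hσ b
    exact ⟨a • m, by rw [tmul_smul, one_mul]⟩
  | add x y hx hy =>
    obtain ⟨m, rfl⟩ := hx
    obtain ⟨n, rfl⟩ := hy
    exact ⟨m + n, (tmul_add σ 1 m n).symm⟩

end SigmaPullback

open SigmaPullback

theorem semilinearOf_lift (g : M →ₛₗ[σ] M) : semilinearOf (lift σ g) = g := by
  ext m
  exact (lift_tmul σ g 1 m).trans (one_smul R _)

theorem isTauMorphism_iff {τ : SigmaPullback σ M →ₗ[R] M} {τ' : SigmaPullback σ N →ₗ[R] N}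
    {f : M →ₗ[R] N} :
    IsTauMorphism τ τ' f ↔ ∀ m, semilinearOf τ' (f m) = f (semilinearOf τ m) :=
  ⟨fun h m => h.apply_semilinearOf m, fun h => hom_ext fun m => by
    rw [LinearMap.comp_apply, LinearMap.comp_apply, map_tmul]; exact (h m).symm⟩

/-- The restriction of `τ` to a submodule which is stable under the semilinear map attached
to `τ`. -/
def restrictTau (τ : SigmaPullback σ M →ₗ[R] M) (N : Submodule R M)
    (hN : ∀ n ∈ N, semilinearOf τ n ∈ N) : SigmaPullback σ N →ₗ[R] N :=
  lift σ (LinearMap.codRestrict N ((semilinearOf τ).domRestrict N) fun n => hN n n.2)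

theorem semilinearOf_restrictTau (τ : SigmaPullback σ M →ₗ[R] M) (N : Submodule R M)
    (hN : ∀ n ∈ N, semilinearOf τ n ∈ N) (n : N) :
    (semilinearOf (restrictTau τ N hN) n : M) = semilinearOf τ n := by
  rw [restrictTau, semilinearOf_lift]; rfl

theorem isTauMorphism_subtype (τ : SigmaPullback σ M →ₗ[R] M) (N : Submodule R M)
    (hN : ∀ n ∈ N, semilinearOf τ n ∈ N) : IsTauMorphism (restrictTau τ N hN) τ N.subtype :=
  isTauMorphism_iff.mpr fun n => (semilinearOf_restrictTau τ N hN n).symm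

theorem semilinearOf_cokerTau {τ : SigmaPullback σ M →ₗ[R] M} {τ' : SigmaPullback σ N →ₗ[R] N}
    {f : M →ₗ[R] N} (hf : IsTauMorphism τ τ' f) (n : N) :
    semilinearOf (cokerTau hf) (Submodule.Quotient.mk n) =
      Submodule.Quotient.mk (semilinearOf τ' n) := by
  rw [cokerTau, semilinearOf_lift]; rfl

theorem semilinearOf_cokerTau_iterate {τ : SigmaPullback σ M →ₗ[R] M}
    {τ' : SigmaPullback σ N →ₗ[R] N} {f : M →ₗ[R] N} (hf : IsTauMorphism τ τ' f) (k : ℕ) (n : N) :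
    (semilinearOf (cokerTau hf))^[k] (Submodule.Quotient.mk n) =
      Submodule.Quotient.mk ((semilinearOf τ')^[k] n) := by
  induction k with
  | zero => rfl
  | succ k ih => rw [Function.iterate_succ_apply', ih, semilinearOf_cokerTau,
      Function.iterate_succ_apply']

end FrobeniusPullback

/-! ### Dimensions over a subfield -/

section RestrictScalarsDimension

variable (L R : Type*) [Field L] [CommRing R] [Algebra L R]
variable {M N K : Type*} [AddCommGroup M] [Module R M] [AddCommGroup N] [Module R N]
  [AddCommGroup K] [Module R K]

/-- The `R`-module `M`, regarded as a vector space over `L`. -/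
def OverField (L R M : Type*) [Field L] [CommRing R] [Algebra L R] [AddCommGroup M]
    [Module R M] : Type _ := M

instance : AddCommGroup (OverField L R M) := inferInstanceAs (AddCommGroup M)

instance : Module L (OverField L R M) := Module.compHom M (algebraMap L R)

/-- An `R`-linear map as an `L`-linear map. -/
def LinearMap.overField (f : M →ₗ[R] N) : OverField L R M →ₗ[L] OverField L R N where
  toFun := f
  map_add' := f.map_add
  map_smul' a x := f.map_smul (algebraMap L R a) x

/-- An `R`-linear equivalence as an `L`-linear equivalence. -/
def LinearEquiv.overField (f : M ≃ₗ[R] N) : OverField L R M ≃ₗ[L] OverField L R N where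
  __ := f.toLinearMap.overField L R
  invFun := f.symm
  left_inv := f.left_inv
  right_inv := f.right_inv

/-- The dimension over `L` of an `R`-module. -/
noncomputable def dimOver (M : Type*) [AddCommGroup M] [Module R M] : ℕ :=
  Module.finrank L (OverField L R M)

/-- The `R`-module `M` is finite-dimensional over `L`. -/
def FiniteOver (M : Type*) [AddCommGroup M] [Module R M] : Prop :=
  Module.Finite L (OverField L R M)

variable {L R}

theorem LinearEquiv.dimOver_eq (e : M ≃ₗ[R] N) : dimOver L R M = dimOver L R N :=
  (e.overField L R).finrank_eq

theorem FiniteOver.of_surjective (h : FiniteOver L R M) (f : M →ₗ[R] N)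
    (hf : Function.Surjective f) : FiniteOver L R N :=
  have : Module.Finite L (OverField L R M) := h
  Module.Finite.of_surjective (f.overField L R) hf

theorem FiniteOver.of_injective (h : FiniteOver L R N) (f : M →ₗ[R] N)
    (hf : Function.Injective f) : FiniteOver L R M :=
  have : Module.Finite L (OverField L R N) := h
  Module.Finite.of_injective (f.overField L R) hf

theorem FiniteOver.of_exact {f : M →ₗ[R] N} {g : N →ₗ[R] K} (hM : FiniteOver L R M)
    (hK : FiniteOver L R K) (h : Function.Exact f g) (hg : Function.Surjective g) :
    FiniteOver L R N := by
  have h1 : Module.Finite L (OverField L R M) := hM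
  have h2 : Module.Finite L (OverField L R K) := hK
  exact Module.Finite.of_exact (f := f.overField L R) (g := g.overField L R) h hg

theorem dimOver_eq_add_of_exact (h : FiniteOver L R N) {f : M →ₗ[R] N} {g : N →ₗ[R] K}
    (hf : Function.Injective f) (hg : Function.Surjective g) (hfg : Function.Exact f g) :
    dimOver L R N = dimOver L R M + dimOver L R K := by
  have : Module.Finite L (OverField L R N) := h
  have h1 := LinearMap.finrank_range_add_finrank_ker (g.overField L R)
  have h2 : LinearMap.ker (g.overField L R) = LinearMap.range (f.overField L R) :=
    LinearMap.exact_iff.mp hfg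
  have h3 : LinearMap.range (g.overField L R) = ⊤ := LinearMap.range_eq_top.mpr hg
  have hf' : Function.Injective (f.overField L R) := hf
  rw [h2, h3, finrank_top,
    LinearMap.finrank_range_of_inj hf', add_comm] at h1
  exact h1.symm

theorem bijective_of_surjective_of_dimOver_eq (h : FiniteOver L R M) (f : M →ₗ[R] N)
    (hf : Function.Surjective f) (hd : dimOver L R M = dimOver L R N) : Function.Bijective f := by
  have h1 : Module.Finite L (OverField L R M) := h
  have h2 : Module.Finite L (OverField L R N) := h.of_surjective f hf
  exact ⟨(LinearMap.injective_iff_surjective_of_finrank_eq_finrank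
    (f := f.overField L R) hd).mpr hf, hf⟩

theorem bijective_of_injective_of_dimOver_eq (hM : FiniteOver L R M) (hN : FiniteOver L R N)
    (f : M →ₗ[R] N) (hf : Function.Injective f) (hd : dimOver L R M = dimOver L R N) :
    Function.Bijective f := by
  have h1 : Module.Finite L (OverField L R M) := hM
  have h2 : Module.Finite L (OverField L R N) := hN
  exact ⟨hf, (LinearMap.injective_iff_surjective_of_finrank_eq_finrank
    (f := f.overField L R) hd).mp hf⟩

theorem FiniteOver.submodule (h : FiniteOver L R M) (A : Submodule R M) : FiniteOver L R A :=
  h.of_injective A.subtype A.subtype_injective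

theorem FiniteOver.dimOver_lt (h : FiniteOver L R M) {A B : Submodule R M} (hAB : A < B) :
    dimOver L R A < dimOver L R B := by
  have : FiniteOver L R B := h.submodule B
  have h1 : Module.Finite L (OverField L R B) := this
  refine lt_of_le_of_ne (LinearMap.finrank_le_finrank_of_injective
    (f := (Submodule.inclusion hAB.le).overField L R) (Submodule.inclusion_injective hAB.le))
    fun he => hAB.not_ge ?_
  have := (bijective_of_injective_of_dimOver_eq (h.submodule A) this
    (Submodule.inclusion hAB.le) (Submodule.inclusion_injective hAB.le) he).2
  intro b hb
  obtain ⟨a, ha⟩ := this ⟨b, hb⟩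
  have h2 : (a : M) = b := congrArg Subtype.val ha
  rw [← h2]
  exact a.2

theorem FiniteOver.eq_of_dimOver_eq_zero (h : FiniteOver L R M) {A : Submodule R M}
    (hA : dimOver L R A = 0) : A = ⊥ := by
  by_contra hne
  have := h.dimOver_lt (bot_lt_iff_ne_bot.mpr hne)
  omega

theorem injective_mapQ_subtype (A B : Submodule R M) :
    Function.Injective ((A.comap B.subtype).mapQ A B.subtype le_rfl) := by
  rw [← LinearMap.ker_eq_bot, Submodule.ker_mapQ, Submodule.mkQ_map_self]

theorem exact_mapQ_subtype_factor {A B : Submodule R M} (hAB : A ≤ B) :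
    Function.Exact ((A.comap B.subtype).mapQ A B.subtype le_rfl) (Submodule.factor hAB) := by
  intro x
  obtain ⟨x, rfl⟩ := A.mkQ_surjective x
  constructor
  · intro h
    have hx : x ∈ B := (Submodule.Quotient.mk_eq_zero B).mp h
    exact ⟨Submodule.Quotient.mk ⟨x, hx⟩, rfl⟩
  · rintro ⟨y, hy⟩
    obtain ⟨y, rfl⟩ := Submodule.mkQ_surjective _ y
    rw [← hy]
    exact (Submodule.Quotient.mk_eq_zero B).mpr y.2

/-- If `A ≤ B` are submodules of `M` then `dim M / A = dim B / A + dim M / B`. -/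
theorem dimOver_quotient_eq_add {A B : Submodule R M} (hAB : A ≤ B)
    (hfin : FiniteOver L R (M ⧸ A)) :
    dimOver L R (M ⧸ A) = dimOver L R (B ⧸ A.comap B.subtype) + dimOver L R (M ⧸ B) :=
  dimOver_eq_add_of_exact hfin (injective_mapQ_subtype A B) (Submodule.factor_surjective hAB)
    (exact_mapQ_subtype_factor hAB)

theorem finiteOver_quotient_of_le {A B : Submodule R M} (hAB : A ≤ B)
    (h1 : FiniteOver L R (B ⧸ A.comap B.subtype)) (h2 : FiniteOver L R (M ⧸ B)) :
    FiniteOver L R (M ⧸ A) :=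
  h1.of_exact h2 (exact_mapQ_subtype_factor hAB) (Submodule.factor_surjective hAB)

/-- An ideal which is nilpotent on a `d`-dimensional module has vanishing `d`-th power on it. -/
theorem pow_dimOver_le_annihilator (h : FiniteOver L R M) (J : Ideal R) {n : ℕ}
    (hn : J ^ n ≤ Module.annihilator R M) :
    J ^ dimOver L R M ≤ Module.annihilator R M := by
  -- The chain `J ^ i M` loses at least one dimension per step until it stabilizes. A stable term is
  -- unchanged by `J ^ n`, which annihilates `M`, so that term is zero.
  have key : ∀ i, J ^ i • (⊤ : Submodule R M) = ⊥ ∨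
      dimOver L R (J ^ i • (⊤ : Submodule R M) : Submodule R M) + i ≤ dimOver L R M := by
    intro i
    induction i with
    | zero =>
      right
      rw [pow_zero, Ideal.one_eq_top, Submodule.top_smul, add_zero]
      exact (Submodule.topEquiv.dimOver_eq).le
    | succ i ih =>
      obtain ih | ih := ih
      · left; rw [pow_succ', Submodule.mul_smul, ih, Submodule.smul_bot]
      · have hle : J ^ (i + 1) • (⊤ : Submodule R M) ≤ J ^ i • ⊤ :=
          Submodule.smul_mono_left (Ideal.pow_le_pow_right (Nat.le_succ i))
        obtain hlt | heq := hle.lt_or_eq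
        · right
          have := h.dimOver_lt hlt
          omega
        · left
          have hstab : ∀ m, J ^ m • (J ^ i • (⊤ : Submodule R M)) = J ^ i • ⊤ := by
            intro m
            induction m with
            | zero => rw [pow_zero, Ideal.one_eq_top, Submodule.top_smul]
            | succ m ihm => rw [pow_succ, Submodule.mul_smul, ← Submodule.mul_smul J, ← pow_succ',
                heq, ihm]
          rw [heq, ← hstab n, eq_bot_iff]
          refine (Submodule.smul_mono hn le_top).trans ?_
          rw [← Submodule.annihilator_top, Submodule.annihilator_smul]
  have hz : J ^ dimOver L R M • (⊤ : Submodule R M) = ⊥ := by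
    obtain h' | h' := key (dimOver L R M)
    · exact h'
    · exact h.eq_of_dimOver_eq_zero (by omega)
  intro a ha
  rw [Module.mem_annihilator]
  intro m
  have : a • m ∈ J ^ dimOver L R M • (⊤ : Submodule R M) :=
    Submodule.smul_mem_smul ha trivial
  rwa [hz] at this

/-- A finitely generated torsion module is killed by one nonzero `a`, so it is a quotient of some
`(R / a) ^ n`. -/
theorem FiniteOver.of_isTorsion [IsDomain R] (hR : ∀ I : Ideal R, I ≠ ⊥ → Module.Finite L (R ⧸ I))
    [Module.Finite R K] (hK : Module.IsTorsion R K) : FiniteOver L R K := by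
  obtain ⟨a, ha, ha0⟩ := Submodule.annihilator_top_inter_nonZeroDivisors hK
  let I : Ideal R := Ideal.span {a}
  have hI : I ≠ ⊥ := by
    rw [Ne, Ideal.span_singleton_eq_bot]; exact nonZeroDivisors.ne_zero ha0
  obtain ⟨n, f, hf⟩ := Module.Finite.exists_fin' R K
  have h1 : FiniteOver L R (R ⧸ I) := by
    have := hR I hI
    exact Module.Finite.of_surjective
      ({ toFun := id
         map_add' := fun _ _ => rfl
         map_smul' := fun b x => (algebraMap_smul R b x).symm } :
        (R ⧸ I) →ₗ[L] OverField L R (R ⧸ I)) Function.surjective_id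
  have h2 : FiniteOver L R (Fin n → R ⧸ I) := by
    have : Module.Finite L (OverField L R (R ⧸ I)) := h1
    exact Module.Finite.of_surjective
      ({ toFun := id, map_add' := fun _ _ => rfl, map_smul' := fun b x => rfl } :
        (Fin n → OverField L R (R ⧸ I)) →ₗ[L] OverField L R (Fin n → R ⧸ I)) Function.surjective_id
  have hle : ∀ k : K, I ≤ LinearMap.ker (LinearMap.toSpanSingleton R K k) := fun k => by
    rw [Ideal.span_singleton_le_iff_mem, LinearMap.mem_ker, LinearMap.toSpanSingleton_apply]
    exact (Submodule.mem_annihilator.mp ha) k trivial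
  refine h2.of_surjective (∑ i, (I.liftQ (LinearMap.toSpanSingleton R K (f (Pi.single i 1)))
    (hle _)) ∘ₗ LinearMap.proj i) fun k => ?_
  obtain ⟨v, rfl⟩ := hf k
  refine ⟨fun i => Submodule.Quotient.mk (v i), ?_⟩
  rw [LinearMap.pi_apply_eq_sum_univ f v, LinearMap.sum_apply]
  refine Finset.sum_congr rfl fun i _ => ?_
  rw [LinearMap.comp_apply, LinearMap.proj_apply, Submodule.liftQ_apply,
    LinearMap.toSpanSingleton_apply]
  congr 2
  ext j
  simp [Pi.single_apply, eq_comm]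

end RestrictScalarsDimension

/-! ### Frobenius pullback and dimensions over `L` -/

section SigmaHomDimension

/-- Additive maps out of `σ^* M`. -/
def SigmaPullback.liftAdd {R : Type*} [CommRing R] (σ : R →+* R) {M P : Type*} [AddCommGroup M]
    [Module R M] [AddCommGroup P] (f : R →+ M →+ P)
    (h : ∀ r b m, f (σ r * b) m = f b (r • m)) : SigmaPullback σ M →+ P :=
  TensorProduct.liftAddHom (R := R) (M := Twist σ) (N := M)
    (AddMonoidHom.mk' (fun b => f (show R from b)) fun b b' => f.map_add b b')
    fun r b m => h r b m

theorem SigmaPullback.liftAdd_tmul {R : Type*} [CommRing R] (σ : R →+* R) {M P : Type*}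
    [AddCommGroup M] [Module R M] [AddCommGroup P] (f : R →+ M →+ P)
    (h : ∀ r b m, f (σ r * b) m = f b (r • m)) (b : R) (m : M) :
    liftAdd σ f h (tmul σ b m) = f b m := rfl

theorem SigmaPullback.zero_tmul {R : Type*} [CommRing R] (σ : R →+* R) {M : Type*} [AddCommGroup M]
    [Module R M] (m : M) : tmul σ 0 m = 0 := by
  rw [← zero_mul (1 : R), ← smul_tmul, zero_smul]

theorem SigmaPullback.add_tmul {R : Type*} [CommRing R] (σ : R →+* R) {M : Type*} [AddCommGroup M]
    [Module R M] (a b : R) (m : M) : tmul σ (a + b) m = tmul σ a m + tmul σ b m := by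
  rw [← mul_one a, ← mul_one b, ← add_mul, ← smul_tmul, ← smul_tmul, ← smul_tmul, add_smul]

variable {Fq L A : Type*} [Field Fq] [Field L] [Algebra Fq L] [CommRing A]
  [Algebra Fq A] {K : Type*} [AddCommGroup K] [Module (L ⊗[Fq] A) K]

theorem tmul_one_smul [Module L K] [IsScalarTower L (L ⊗[Fq] A) K] (l : L) (m : K) :
    (l ⊗ₜ[Fq] (1 : A)) • m = l • m :=
  algebraMap_smul (L ⊗[Fq] A) l m

variable [Fintype Fq] [Module L K] [IsScalarTower L (L ⊗[Fq] A) K]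

/-- The pairing `(l ⊗ a, m) ↦ l φ(a m)^q` attached to an `L`-linear form `φ`. -/
noncomputable def frobeniusPairing (φ : K →ₗ[L] L) : L ⊗[Fq] A →+ K →+ L :=
  TensorProduct.liftAddHom
    (AddMonoidHom.mk' (fun l => AddMonoidHom.mk' (fun a => AddMonoidHom.mk' (fun m =>
        l * FiniteField.frobeniusAlgHom Fq L (φ ((1 ⊗ₜ[Fq] a : L ⊗[Fq] A) • m)))
      fun m n => by rw [smul_add, map_add, map_add, mul_add])
      fun a b => by
        ext m
        change l * _ = l * _ + l * _
        rw [TensorProduct.tmul_add, add_smul, map_add, map_add, mul_add])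
      fun l l' => by
        ext a m
        exact add_mul _ _ _)
    fun r l a => by
      ext m
      change (r • l) * _ = l * _
      have h : (1 ⊗ₜ[Fq] (r • a) : L ⊗[Fq] A) • m =
          algebraMap Fq L r • (1 ⊗ₜ[Fq] a : L ⊗[Fq] A) • m := by
        rw [← tmul_one_smul (Fq := Fq) (A := A), smul_smul, Algebra.TensorProduct.tmul_mul_tmul, mul_one,
          one_mul, TensorProduct.tmul_smul, TensorProduct.smul_tmul', Algebra.smul_def, mul_one]
      rw [h, φ.map_smul, smul_eq_mul, map_mul, AlgHom.commutes, Algebra.smul_def]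
      ring

theorem frobeniusPairing_tmul (φ : K →ₗ[L] L) (l : L) (a : A) (m : K) :
    frobeniusPairing φ (l ⊗ₜ[Fq] a) m =
      l * FiniteField.frobeniusAlgHom Fq L (φ ((1 ⊗ₜ[Fq] a : L ⊗[Fq] A) • m)) := rfl

theorem frobeniusPairing_balanced (φ : K →ₗ[L] L) (r b : L ⊗[Fq] A)
    (m : K) : frobeniusPairing φ (sigmaHom Fq L A r * b) m = frobeniusPairing φ b (r • m) := by
  induction b with
  | zero => simp
  | add x y hx hy => rw [mul_add, map_add, map_add, AddMonoidHom.add_apply, hx, hy]; rfl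
  | tmul l a =>
    induction r with
    | zero => simp
    | add x y hx hy => rw [map_add, add_mul, map_add, AddMonoidHom.add_apply, hx, hy, add_smul,
        map_add]
    | tmul l' a' =>
      rw [sigmaHom_tmul, Algebra.TensorProduct.tmul_mul_tmul, frobeniusPairing_tmul,
        frobeniusPairing_tmul]
      have h : (1 ⊗ₜ[Fq] a : L ⊗[Fq] A) • (l' ⊗ₜ[Fq] a' : L ⊗[Fq] A) • m =
          l' • (1 ⊗ₜ[Fq] (a' * a) : L ⊗[Fq] A) • m := by
        rw [← tmul_one_smul (Fq := Fq) (A := A), smul_smul, smul_smul, Algebra.TensorProduct.tmul_mul_tmul,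
          Algebra.TensorProduct.tmul_mul_tmul, mul_one, one_mul, one_mul, mul_comm a]
      rw [h, φ.map_smul, smul_eq_mul, map_mul]
      change l' ^ Fintype.card Fq * l * _ = l * (l' ^ Fintype.card Fq * _)
      ring

variable [Module L (SigmaPullback (sigmaHom Fq L A) K)]
  [IsScalarTower L (L ⊗[Fq] A) (SigmaPullback (sigmaHom Fq L A) K)]

/-- The linear form `b ⊗ m ↦ b φ(m)^q` on `σ^* K` attached to a linear form `φ` on `K`. -/
noncomputable def frobeniusForm (φ : K →ₗ[L] L) :
    SigmaPullback (sigmaHom Fq L A) K →ₗ[L] L where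
  __ := SigmaPullback.liftAdd (sigmaHom Fq L A) (frobeniusPairing φ) (frobeniusPairing_balanced φ)
  map_smul' l x := by
    change SigmaPullback.liftAdd _ _ _ (l • x) = l * SigmaPullback.liftAdd _ _ _ x
    induction x using SigmaPullback.induction_on with
    | zero => rw [smul_zero, map_zero, mul_zero]
    | tmul b m =>
      rw [← tmul_one_smul (Fq := Fq) (A := A), SigmaPullback.smul_tmul, SigmaPullback.liftAdd_tmul,
        SigmaPullback.liftAdd_tmul]
      induction b with
      | zero => simp
      | add x y hx hy => rw [mul_add, map_add, map_add, AddMonoidHom.add_apply, hx, hy,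
          AddMonoidHom.add_apply, mul_add]
      | tmul l' a => rw [Algebra.TensorProduct.tmul_mul_tmul, frobeniusPairing_tmul,
          frobeniusPairing_tmul, one_mul, mul_assoc]
    | add x y hx hy => rw [smul_add, map_add, map_add, hx, hy, mul_add]

theorem frobeniusForm_tmul_one (φ : K →ₗ[L] L) (m : K) :
    frobeniusForm φ (SigmaPullback.tmul (sigmaHom Fq L A) 1 m) =
      FiniteField.frobeniusAlgHom Fq L (φ m) := by
  refine (frobeniusPairing_tmul φ 1 1 m).trans ?_
  rw [one_mul, ← Algebra.TensorProduct.one_def, one_smul]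

/-- A basis of `K` over `L` gives a basis of `σ^* K` over `L`. -/
noncomputable def basisSigmaPullback {ι : Type*} [Fintype ι] (b : Module.Basis ι L K) :
    Module.Basis ι L (SigmaPullback (sigmaHom Fq L A) K) :=
  Module.Basis.mk (v := fun i => SigmaPullback.tmul (sigmaHom Fq L A) 1 (b i))
    (by
      classical
      rw [Fintype.linearIndependent_iff]
      intro g hg i
      -- The form attached to the `i`-th coordinate takes `1 ⊗ b j` to `1` or `0`, and so extracts
      -- the coefficient `g i`.
      have h := congrArg (frobeniusForm (b.coord i)) hg
      rw [map_zero, map_sum, Finset.sum_eq_single i] at h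
      · rw [map_smul, frobeniusForm_tmul_one, Module.Basis.coord_apply, Module.Basis.repr_self,
          Finsupp.single_eq_same, map_one, smul_eq_mul, mul_one] at h
        exact h
      · intro j _ hj
        rw [map_smul, frobeniusForm_tmul_one, Module.Basis.coord_apply, Module.Basis.repr_self,
          Finsupp.single_eq_of_ne hj.symm, map_zero, smul_zero]
      · exact fun hi => absurd (Finset.mem_univ i) hi)
    (by
      intro x _
      induction x using SigmaPullback.induction_on with
      | zero => exact zero_mem _
      | add x y hx hy => exact add_mem (hx trivial) (hy trivial)
      | tmul c m =>
        induction c with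
        | zero => rw [SigmaPullback.zero_tmul]; exact zero_mem _
        | add x y hx hy => rw [SigmaPullback.add_tmul]; exact add_mem (hx trivial) (hy trivial)
        | tmul l a =>
          -- `σ` fixes `1 ⊗ a`, so this factor can be moved onto `m`; only a scalar from `L` remains
          -- on the left.
          have h : SigmaPullback.tmul (sigmaHom Fq L A) (l ⊗ₜ a) m = (l ⊗ₜ[Fq] (1 : A)) •
              SigmaPullback.tmul (sigmaHom Fq L A) 1 ((1 ⊗ₜ[Fq] a : L ⊗[Fq] A) • m) := by
            rw [SigmaPullback.tmul_smul, SigmaPullback.smul_tmul, sigmaHom_tmul, one_mul,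
              Algebra.TensorProduct.tmul_mul_tmul, one_mul, one_pow, mul_one]
          rw [h, tmul_one_smul]
          refine Submodule.smul_mem _ l ?_
          rw [← b.sum_repr ((1 ⊗ₜ[Fq] a : L ⊗[Fq] A) • m)]
          change SigmaPullback.unit (sigmaHom Fq L A) _ ∈ _
          rw [map_sum]
          refine Submodule.sum_mem _ fun i _ => ?_
          rw [← tmul_one_smul (Fq := Fq) (A := A), map_smulₛₗ, sigmaHom_tmul, tmul_one_smul]
          exact Submodule.smul_mem _ _ (Submodule.subset_span ⟨i, rfl⟩))

end SigmaHomDimension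

section SigmaHomDimension

variable {Fq L A : Type*} [Field Fq] [Fintype Fq] [Field L] [Algebra Fq L] [CommRing A]
  [Algebra Fq A] {K : Type*} [AddCommGroup K] [Module (L ⊗[Fq] A) K]

/-- The Frobenius pullback preserves dimensions over `L`. -/
theorem FiniteOver.sigmaPullback (h : FiniteOver L (L ⊗[Fq] A) K) :
    FiniteOver L (L ⊗[Fq] A) (SigmaPullback (sigmaHom Fq L A) K) ∧
      dimOver L (L ⊗[Fq] A) (SigmaPullback (sigmaHom Fq L A) K) = dimOver L (L ⊗[Fq] A) K := by
  let _ : Module L K := Module.compHom K (algebraMap L (L ⊗[Fq] A))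
  have : IsScalarTower L (L ⊗[Fq] A) K := .of_algebraMap_smul fun _ _ => rfl
  let _ : Module L (SigmaPullback (sigmaHom Fq L A) K) :=
    Module.compHom _ (algebraMap L (L ⊗[Fq] A))
  have : IsScalarTower L (L ⊗[Fq] A) (SigmaPullback (sigmaHom Fq L A) K) :=
    .of_algebraMap_smul fun _ _ => rfl
  have : Module.Finite L K := h
  let b := basisSigmaPullback (Fq := Fq) (A := A) (Module.finBasis L K)
  exact ⟨b.finiteDimensional_of_finite,
    (Module.finrank_eq_card_basis b).trans (Fintype.card_fin _)⟩

end SigmaHomDimension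

/-! ### Dimensions of cokernels under isogenies -/

section CokernelDimension

open SigmaPullback

variable {Fq L A : Type*} [Field Fq] [Fintype Fq] [Field L] [Algebra Fq L] [CommRing A]
  [Algebra Fq A] {M : Type*} [AddCommGroup M] [Module (L ⊗[Fq] A) M]

/-- `τ(σ^* M) / τ(σ^* N)` is isomorphic to `σ^* (M / N)`. -/
noncomputable def rangeQuotientEquiv {R : Type*} [CommRing R] {σ : R →+* R} {M N : Type*}
    [AddCommGroup M] [Module R M] [AddCommGroup N] [Module R N] (τ : SigmaPullback σ M →ₗ[R] M)
    (hτ : Function.Injective τ) (f : N →ₗ[R] M) :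
    (LinearMap.range τ ⧸ ((LinearMap.range (SigmaPullback.map σ f)).map τ).comap
      (LinearMap.range τ).subtype) ≃ₗ[R] SigmaPullback σ (M ⧸ LinearMap.range f) :=
  let g := Submodule.mkQ (((LinearMap.range (SigmaPullback.map σ f)).map τ).comap
    (LinearMap.range τ).subtype) ∘ₗ τ.rangeRestrict
  (g.quotKerEquivOfSurjective
    ((Submodule.mkQ_surjective _).comp τ.surjective_rangeRestrict)).symm ≪≫ₗ
  Submodule.quotEquivOfEq _ _ (by
    have h := LinearMap.exact_iff.mp
      (map_exact (σ := σ) f.exact_map_mkQ_range (LinearMap.range f).mkQ_surjective)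
    rw [h]
    ext x
    rw [LinearMap.mem_ker, LinearMap.comp_apply, Submodule.mkQ_apply,
      Submodule.Quotient.mk_eq_zero, Submodule.mem_comap]
    exact hτ.mem_set_image) ≪≫ₗ
  (SigmaPullback.map σ (LinearMap.range f).mkQ).quotKerEquivOfSurjective
    (map_surjective (LinearMap.range f).mkQ_surjective)

/-- The quotient of the image of an injective map by the image of a submodule. -/
noncomputable def quotientMapEquiv {R M N : Type*} [CommRing R]
    [AddCommGroup M] [Module R M] [AddCommGroup N] [Module R N] (f : N →ₗ[R] M)
    (hf : Function.Injective f) (I : Submodule R N) :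
    (N ⧸ I) ≃ₗ[R] LinearMap.range f ⧸ (I.map f).comap (LinearMap.range f).subtype :=
  Submodule.Quotient.equiv _ _ (LinearEquiv.ofInjective f hf) (by
    ext ⟨_, x, rfl⟩
    rw [Submodule.mem_comap]
    change _ ↔ f x ∈ f '' I
    rw [hf.mem_set_image]
    exact (LinearEquiv.ofInjective f hf).injective.mem_set_image)

/-- Sub-objects with finite-dimensional quotient have cokernels of the same dimension. -/
theorem dimOver_coker_eq {N : Type*} [AddCommGroup N] [Module (L ⊗[Fq] A) N]
    {τ : SigmaPullback (sigmaHom Fq L A) M →ₗ[L ⊗[Fq] A] M} (hτ : Function.Injective τ)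
    {τN : SigmaPullback (sigmaHom Fq L A) N →ₗ[L ⊗[Fq] A] N} {f : N →ₗ[L ⊗[Fq] A] M}
    (hf : IsTauMorphism τN τ f) (hf' : Function.Injective f)
    (hMN : FiniteOver L (L ⊗[Fq] A) (M ⧸ LinearMap.range f))
    (hcoker : FiniteOver L (L ⊗[Fq] A) (M ⧸ LinearMap.range τ)) :
    FiniteOver L (L ⊗[Fq] A) (N ⧸ LinearMap.range τN) ∧
      dimOver L (L ⊗[Fq] A) (N ⧸ LinearMap.range τN) =
        dimOver L (L ⊗[Fq] A) (M ⧸ LinearMap.range τ) := by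
  obtain ⟨h1, h2⟩ := hMN.sigmaPullback
  -- This submodule is `τ(σ^* N)`, which lies both in `N` and in `τ(σ^* M)`. The dimension of its
  -- quotient is computed along both chains, and the terms `dim M / N` and `dim σ^*(M / N)` cancel.
  have heq : (LinearMap.range τN).map f =
      (LinearMap.range (SigmaPullback.map (sigmaHom Fq L A) f)).map τ := by
    rw [← LinearMap.range_comp, ← LinearMap.range_comp, hf]
  have hle1 : (LinearMap.range τN).map f ≤ LinearMap.range f := LinearMap.map_le_range
  have hle2 : (LinearMap.range τN).map f ≤ LinearMap.range τ := by
    rw [heq]; exact LinearMap.map_le_range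
  have e := rangeQuotientEquiv τ hτ f
  rw [← heq] at e
  have hfin := finiteOver_quotient_of_le hle2 (h1.of_injective e.toLinearMap e.injective) hcoker
  have d1 := dimOver_quotient_eq_add hle1 hfin
  have d2 := dimOver_quotient_eq_add hle2 hfin
  rw [e.dimOver_eq, h2] at d2
  have hinj := injective_mapQ_subtype ((LinearMap.range τN).map f) (LinearMap.range f)
  have f1 := hfin.of_injective _ hinj
  have e2 := quotientMapEquiv f hf' (LinearMap.range τN)
  rw [← e2.dimOver_eq] at d1
  exact ⟨f1.of_injective e2.toLinearMap e2.injective, by omega⟩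

end CokernelDimension

/-! ### Lattices over a Dedekind domain -/

section Lattices

variable {R : Type*} [CommRing R] [IsDedekindDomain R] {M : Type*} [AddCommGroup M] [Module R M]

theorem Submodule.projective_of_isDedekindDomain [Module.Finite R M] [Module.Projective R M]
    (N : Submodule R M) : Module.Projective R N := by
  have h1 : Module.IsTorsionFree R M := inferInstance
  have h2 : Module.IsTorsionFree R N := inferInstance
  have h3 : Module.Flat R N := inferInstance
  have h4 : Module.FinitePresentation R N := Module.finitePresentation_of_finite R N
  exact Module.Flat.projective_of_finitePresentation

variable (S : Type*) [CommRing S] [Nontrivial S] [Algebra R S]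

/-- Finite projective modules over a Dedekind domain with isomorphic base changes have the same
rank everywhere. -/
theorem rankAtStalk_eq_of_baseChange_equiv {N : Type*} [AddCommGroup N] [Module R N]
    [Module.Finite R M] [Module.Projective R M] [Module.Finite R N] [Module.Projective R N]
    (e : S ⊗[R] N ≃ₗ[S] S ⊗[R] M) (p : PrimeSpectrum R) :
    Module.rankAtStalk N p = Module.rankAtStalk M p := by
  obtain ⟨m, hm⟩ := Ideal.exists_maximal S
  let q : PrimeSpectrum S := ⟨m, hm.isPrime⟩
  have hN := Module.rankAtStalk_baseChange (R := R) (M := N) q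
  have hM := Module.rankAtStalk_baseChange (R := R) (M := M) q
  rw [Module.rankAtStalk_eq_of_equiv e, hM] at hN
  -- The rank is constant under specialization and every prime specializes the generic one, so a
  -- comparison at the single prime below `q` suffices.
  have h : ∀ p : PrimeSpectrum R, (⊥ : PrimeSpectrum R) ≤ p := fun p => bot_le
  rw [← Module.rankAtStalk_eq_of_le_of_finite_of_flat N (h p),
    ← Module.rankAtStalk_eq_of_le_of_finite_of_flat M (h p),
    Module.rankAtStalk_eq_of_le_of_finite_of_flat N (h (PrimeSpectrum.comap (algebraMap R S) q)),
    Module.rankAtStalk_eq_of_le_of_finite_of_flat M (h (PrimeSpectrum.comap (algebraMap R S) q)),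
    hN]

end Lattices

section Lattices

variable {R : Type*} [CommRing R] {M : Type*} [AddCommGroup M] [Module R M]

/-- The base change of an injective map whose image contains `a M` is bijective as soon as `a`
becomes invertible. -/
theorem bijective_baseChange_of_smul_mem_range {N : Type*} [AddCommGroup N] [Module R N]
    (S : Type*) [CommRing S] [Algebra R S] {f : N →ₗ[R] M} (hf : Function.Injective f)
    (a : R) (ha : IsUnit (algebraMap R S a)) (hN : ∀ m : M, a • m ∈ LinearMap.range f) :
    Function.Bijective (f.baseChange S) := by
  -- `g` is `a` times the inverse of `f`: both composites are multiplication by `a`, which is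
  -- invertible over `S`.
  let g : M →ₗ[R] N := (LinearEquiv.ofInjective f hf).symm.toLinearMap ∘ₗ
    (LinearMap.lsmul R M a).codRestrict (LinearMap.range f) hN
  have hfg : ∀ m, f (g m) = a • m := fun m =>
    congrArg Subtype.val ((LinearEquiv.ofInjective f hf).apply_symm_apply ⟨a • m, hN m⟩)
  have hgf : ∀ n, g (f n) = a • n := fun n => hf (by rw [hfg, map_smul])
  have h1 : ∀ x, g.baseChange S (f.baseChange S x) = algebraMap R S a • x := by
    intro x
    induction x with
    | zero => simp
    | add x y hx hy => rw [map_add, map_add, hx, hy, smul_add]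
    | tmul s n => rw [LinearMap.baseChange_tmul, LinearMap.baseChange_tmul, algebraMap_smul,
        ← TensorProduct.tmul_smul, hgf]
  have h2 : ∀ x, f.baseChange S (g.baseChange S x) = algebraMap R S a • x := by
    intro x
    induction x with
    | zero => simp
    | add x y hx hy => rw [map_add, map_add, hx, hy, smul_add]
    | tmul s n => rw [LinearMap.baseChange_tmul, LinearMap.baseChange_tmul, algebraMap_smul,
        ← TensorProduct.tmul_smul, hfg]
  constructor
  · intro x y hxy
    have := congrArg (g.baseChange S) hxy
    rw [h1, h1] at this
    exact ha.smul_left_cancel.mp this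
  · intro y
    obtain ⟨u, hu⟩ := ha
    refine ⟨g.baseChange S (u⁻¹ • y), ?_⟩
    rw [h2, ← hu]
    exact smul_inv_smul u y

theorem exists_smul_mem_of_isTorsion [IsDomain R] [Module.Finite R M] (N : Submodule R M)
    (hN : Module.IsTorsion R (M ⧸ N)) : ∃ a : R, a ≠ 0 ∧ ∀ m : M, a • m ∈ N := by
  obtain ⟨a, ha, ha0⟩ := Submodule.annihilator_top_inter_nonZeroDivisors hN
  refine ⟨a, nonZeroDivisors.ne_zero ha0, fun m => ?_⟩
  have := Submodule.mem_annihilator.mp ha (Submodule.Quotient.mk m) trivial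
  rwa [← Submodule.Quotient.mk_smul, Submodule.Quotient.mk_eq_zero] at this

end Lattices

/-! ### Isogenies into a module with `τ` over `A_L` -/

section TauLattices

variable {Fq L A : Type*} [Field Fq] [Fintype Fq] [Field L] [Algebra Fq L] [CommRing A]
  [Algebra Fq A] {M : Type*} [AddCommGroup M] [Module (L ⊗[Fq] A) M]

/-- Properties of a sub-object with torsion quotient. -/
theorem lattice_of_isTorsion {N : Type*} [AddCommGroup N] [Module (L ⊗[Fq] A) N]
    [IsDedekindDomain (L ⊗[Fq] A)] (S : Type*) [CommRing S]
    [Nontrivial S] [Algebra (L ⊗[Fq] A) S]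
    (hS : ∀ a : L ⊗[Fq] A, a ≠ 0 → IsUnit (algebraMap (L ⊗[Fq] A) S a))
    (hfin : ∀ I : Ideal (L ⊗[Fq] A), I ≠ ⊥ → Module.Finite L ((L ⊗[Fq] A) ⧸ I))
    (hM : Module.Finite (L ⊗[Fq] A) M) (hM' : Module.Projective (L ⊗[Fq] A) M)
    {τ : SigmaPullback (sigmaHom Fq L A) M →ₗ[L ⊗[Fq] A] M} (hτ : Function.Injective τ)
    (hcoker : FiniteOver L (L ⊗[Fq] A) (M ⧸ LinearMap.range τ))
    {τN : SigmaPullback (sigmaHom Fq L A) N →ₗ[L ⊗[Fq] A] N} {f : N →ₗ[L ⊗[Fq] A] M}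
    (hf : IsIsogeny τN τ f) {J : Ideal (L ⊗[Fq] A)}
    (hJ : ∃ n, J ^ n ≤ Module.annihilator (L ⊗[Fq] A) (N ⧸ LinearMap.range τN)) :
    Module.Finite (L ⊗[Fq] A) N ∧ Module.Projective (L ⊗[Fq] A) N ∧
    (∀ p : PrimeSpectrum (L ⊗[Fq] A), Module.rankAtStalk N p = Module.rankAtStalk M p) ∧
    Function.Injective τN ∧
    FiniteOver L (L ⊗[Fq] A) (N ⧸ LinearMap.range τN) ∧
    dimOver L (L ⊗[Fq] A) (N ⧸ LinearMap.range τN) =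
      dimOver L (L ⊗[Fq] A) (M ⧸ LinearMap.range τ) ∧
    J ^ dimOver L (L ⊗[Fq] A) (M ⧸ LinearMap.range τ) ≤
      Module.annihilator (L ⊗[Fq] A) (N ⧸ LinearMap.range τN) ∧
    Function.Bijective (f.baseChange S) := by
  have hnoeth : IsNoetherian (L ⊗[Fq] A) M := isNoetherian_of_isNoetherianRing_of_finite _ _
  have h4 : Module.Finite (L ⊗[Fq] A) N := Module.Finite.of_injective f hf.injective
  have h3' : Module.Projective (L ⊗[Fq] A) (LinearMap.range f) :=
    (LinearMap.range f).projective_of_isDedekindDomain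
  have h3 : Module.Projective (L ⊗[Fq] A) N :=
    .of_equiv (LinearEquiv.ofInjective f hf.injective).symm
  obtain ⟨a, ha0, ha⟩ := exists_smul_mem_of_isTorsion _ hf.torsion
  have hb := bijective_baseChange_of_smul_mem_range S hf.injective a (hS a ha0) ha
  obtain ⟨h5, h6⟩ := dimOver_coker_eq hτ hf.isTauMorphism hf.injective
    (FiniteOver.of_isTorsion hfin hf.torsion) hcoker
  refine ⟨h4, h3, fun p => rankAtStalk_eq_of_baseChange_equiv S (LinearEquiv.ofBijective _ hb) p,
    ?_, h5, h6, ?_, hb⟩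
  -- Flatness of `σ` makes `τ ∘ σ^* f = f ∘ τN` injective, and therefore `τN`.
  · have := hτ.comp (SigmaPullback.map_injective (sigmaHom_flat Fq L A) hf.injective)
    rw [← LinearMap.coe_comp, ← hf.isTauMorphism, LinearMap.coe_comp] at this
    exact Function.Injective.of_comp this
  · rw [← h6]
    obtain ⟨n, hn⟩ := hJ
    exact pow_dimOver_le_annihilator h5 _ hn

end TauLattices

/-! ### Purity at `∞` and pure motives along isogenies -/

namespace RationalPoint

variable {Fq Q L : Type*} [Field Fq] [Field Q] [Algebra Fq Q] [Field L] [Algebra Fq L]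
  (P : RationalPoint Fq Q)

theorem isUnit_algebraMap_KL [IsDomain (L ⊗[Fq] Q)] {a : P.AL L} (ha : a ≠ 0) :
    IsUnit (algebraMap (P.AL L) (P.KL L) a) := by
  change IsUnit (algebraMap (L ⊗[Fq] Q) (P.KL L)
    (Algebra.TensorProduct.map (AlgHom.id Fq L) P.ringAway.val a))
  have hinj : Function.Injective (P.ringAway.val.toLinearMap.lTensor L) :=
    Module.Flat.lTensor_preserves_injective_linearMap _ Subtype.val_injective
  exact IsLocalization.map_units (M := nonZeroDivisors (L ⊗[Fq] Q)) (P.KL L)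
    ⟨_, mem_nonZeroDivisors_of_ne_zero fun h => ha (hinj (h.trans (map_zero _).symm))⟩

variable {P} {M N : Type*} [AddCommGroup M] [Module (P.AL L) M] [AddCommGroup N]
  [Module (P.AL L) N] [Fintype Fq]

theorem genericTau_baseChange {τN : SigmaPullback (P.sigma L) N →ₗ[P.AL L] N}
    {τ : SigmaPullback (P.sigma L) M →ₗ[P.AL L] M} {f : N →ₗ[P.AL L] M}
    (hf : IsTauMorphism τN τ f) (x : P.GenericFibre L N) :
    P.genericTau τ (f.baseChange (P.KL L) x : P.KL L ⊗[P.AL L] M) =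
      (f.baseChange (P.KL L) (P.genericTau τN x) : P.KL L ⊗[P.AL L] M) := by
  refine TensorProduct.induction_on (R := P.AL L) (M := P.KL L) (N := N)
    (motive := fun x => P.genericTau τ (f.baseChange (P.KL L) x : P.KL L ⊗[P.AL L] M) =
      (f.baseChange (P.KL L) (P.genericTau τN x) : P.KL L ⊗[P.AL L] M)) x ?_ ?_ ?_
  · unfold genericTau
    simp only [map_zero]
    rfl
  · intro s n
    unfold genericTau
    rw [LinearMap.baseChange_tmul, TensorProduct.map_tmul, TensorProduct.map_tmul,
      LinearMap.baseChange_tmul, hf.apply_semilinearOf]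
  · intro x y hx hy
    unfold genericTau at hx hy ⊢
    rw [map_add, map_add, map_add, map_add, hx, hy]

/-- Purity is invariant under isomorphisms of generic fibres which are compatible with `τ`. -/
theorem IsPureAtInfinity.of_equiv {τN : SigmaPullback (P.sigma L) N →ₗ[P.AL L] N}
    {τ : SigmaPullback (P.sigma L) M →ₗ[P.AL L] M} (h : P.IsPureAtInfinity τ)
    (E : P.GenericFibre L M ≃ₗ[P.KL L] P.GenericFibre L N)
    (hE : ∀ x, P.genericTau τN (E x) = E (P.genericTau τ x)) : P.IsPureAtInfinity τN := by
  obtain ⟨Λ, k, l, hfg, hspan, hk, hl, heq⟩ := h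
  let E' : P.GenericFibre L M ≃ₗ[P.localRingL L] P.GenericFibre L N := E.restrictScalars _
  refine ⟨Λ.map E'.toLinearMap, k, l, hfg.map _, ?_, hk, hl, ?_⟩
  · have : ((Λ.map E'.toLinearMap : Submodule _ _) : Set (P.GenericFibre L N)) =
      E.toLinearMap '' Λ := rfl
    rw [this, Submodule.span_image, hspan, Submodule.map_top, LinearEquiv.range]
  · have hs : Function.Semiconj E (P.genericTau τ) (P.genericTau τN) := fun x => (hE x).symm
    have h1 : (P.genericTau τN)^[l] '' (Λ.map E'.toLinearMap : Submodule _ _) =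
        E'.toLinearMap '' ((P.genericTau τ)^[l] '' Λ) := by
      change (P.genericTau τN)^[l] '' (E '' Λ) = E '' ((P.genericTau τ)^[l] '' Λ)
      rw [← Set.image_comp, ← Set.image_comp, (hs.iterate_right l).comp_eq]
    rw [h1, Submodule.span_image, Submodule.map_coe, heq]
    change E '' _ = _
    ext y
    obtain ⟨x, rfl⟩ := E.surjective y
    rw [E.injective.mem_set_image]
    refine forall₂_congr fun a _ => ?_
    rw [← map_smul]
    exact (E.injective.mem_set_image (s := (Λ : Set _))).symm

theorem isDomain_tensorProduct {Fq Q : Type*} [Field Fq] [Finite Fq] [Field Q] [Algebra Fq Q]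
    (hQ : IsCurveFunctionField Fq Q) (L : Type*) [Field L] [Algebra Fq L] : IsDomain (L ⊗[Fq] Q) :=
  have := hQ.essFiniteType
  (isDomain_and_isIntegrallyClosed_tensorProduct hQ.isIntClosed).1

/-- Purity refers only to the generic fibre with its `τ`, which an isogeny does not change. -/
theorem IsPureAtInfinity.of_bijective {τN : SigmaPullback (P.sigma L) N →ₗ[P.AL L] N}
    {τ : SigmaPullback (P.sigma L) M →ₗ[P.AL L] M} (h : P.IsPureAtInfinity τ) {f : N →ₗ[P.AL L] M}
    (hf : IsTauMorphism τN τ f) (hf' : Function.Bijective (f.baseChange (P.KL L))) :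
    P.IsPureAtInfinity τN := by
  let E : P.GenericFibre L N ≃ₗ[P.KL L] P.GenericFibre L M := LinearEquiv.ofBijective _ hf'
  refine h.of_equiv E.symm fun x => ?_
  obtain ⟨y, rfl⟩ := E.surjective x
  rw [E.symm_apply_apply]
  apply E.injective
  rw [E.apply_symm_apply]
  exact (genericTau_baseChange hf y).symm

set_option maxHeartbeats 1000000 in
/-- The source of an isogeny to a pure `A`-motive is a pure `A`-motive of the same rank and
dimension, provided that a power of `J` annihilates its cokernel. -/
theorem IsPureAMotive.of_isIsogeny (hQ : IsCurveFunctionField Fq Q) {c : P.ringAway →ₐ[Fq] L}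
    {r d : ℕ} {τ : SigmaPullback (P.sigma L) M →ₗ[P.AL L] M} (h : P.IsPureAMotive c r d τ)
    {τN : SigmaPullback (P.sigma L) N →ₗ[P.AL L] N} {f : N →ₗ[P.AL L] M} (hf : IsIsogeny τN τ f)
    (hJ : ∃ n, P.idealJ c ^ n ≤ Module.annihilator (P.AL L) (N ⧸ LinearMap.range τN)) :
    P.IsPureAMotive c r d τN := by
  obtain ⟨hDed, hfin⟩ := P.isDedekindDomain_AL hQ L
  have hdom := isDomain_tensorProduct hQ L
  have : Nontrivial (P.KL L) :=
    inferInstanceAs (Nontrivial (FractionRing (L ⊗[Fq] Q)))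
  have hS := fun a (ha : a ≠ 0) => P.isUnit_algebraMap_KL (L := L) ha
  have hcoker : FiniteOver L (P.AL L) (M ⧸ LinearMap.range τ) := h.coker_finite
  have hd : dimOver L (P.AL L) (M ⧸ LinearMap.range τ) = d := h.coker_dim
  obtain ⟨h1, h2, h3, h4, h5, h6, h7, h8⟩ := lattice_of_isTorsion (P.KL L) hS hfin h.finite
    h.projective h.injective hcoker hf hJ
  rw [hd] at h6 h7
  exact ⟨h1, h2, fun p => (h3 p).trans (h.rank_eq p), h4, h5, h6, h7,
    h.pure.of_bijective hf.isTauMorphism h8⟩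

end RationalPoint

/-! ### Iterated kernels and images, and restrictions of `τ` -/

section TauSubmodules

variable {R : Type*} [CommRing R] {σ : R →+* R} {M M' K : Type*} [AddCommGroup M] [Module R M]
  [AddCommGroup M'] [Module R M'] [AddCommGroup K] [Module R K]

theorem semilinearOf_iterate_smul (τ : SigmaPullback σ M →ₗ[R] M) (n : ℕ) (a : R) (m : M) :
    (semilinearOf τ)^[n] (a • m) = σ^[n] a • (semilinearOf τ)^[n] m := by
  induction n generalizing a m with
  | zero => rfl
  | succ n ih => rw [Function.iterate_succ_apply, map_smulₛₗ, ih, Function.iterate_succ_apply,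
      Function.iterate_succ_apply]

theorem semilinearOf_iterate_add (τ : SigmaPullback σ M →ₗ[R] M) (n : ℕ) (m m' : M) :
    (semilinearOf τ)^[n] (m + m') = (semilinearOf τ)^[n] m + (semilinearOf τ)^[n] m' := by
  induction n generalizing m m' with
  | zero => rfl
  | succ n ih => rw [Function.iterate_succ_apply, map_add, ih, Function.iterate_succ_apply,
      Function.iterate_succ_apply]

/-- The kernel of the `n`-th iterate of `τ`. -/
def iterateKer (τ : SigmaPullback σ M →ₗ[R] M) (n : ℕ) : Submodule R M where
  carrier := {m | (semilinearOf τ)^[n] m = 0}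
  add_mem' {a b} ha hb := by
    change (semilinearOf τ)^[n] (a + b) = 0
    rw [semilinearOf_iterate_add, ha, hb, add_zero]
  zero_mem' := iterate_map_zero (semilinearOf τ) n
  smul_mem' a m hm := by
    change (semilinearOf τ)^[n] (a • m) = 0
    rw [semilinearOf_iterate_smul, hm, smul_zero]

/-- The image of the `n`-th iterate of `τ`. -/
def iterateRange (τ : SigmaPullback σ M →ₗ[R] M) (n : ℕ) : Submodule R M :=
  Submodule.span R (Set.range (semilinearOf τ)^[n])

theorem iterateKer_le_succ (τ : SigmaPullback σ M →ₗ[R] M) (n : ℕ) :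
    iterateKer τ n ≤ iterateKer τ (n + 1) := fun m (hm : (semilinearOf τ)^[n] m = 0) => by
  change (semilinearOf τ)^[n + 1] m = 0
  rw [Function.iterate_succ_apply', hm, map_zero]

theorem iterateRange_succ_le (τ : SigmaPullback σ M →ₗ[R] M) (n : ℕ) :
    iterateRange τ (n + 1) ≤ iterateRange τ n := by
  refine Submodule.span_mono ?_
  rintro _ ⟨m, rfl⟩
  exact ⟨semilinearOf τ m, rfl⟩

variable {L : Type*} [Field L] [Algebra L R]

theorem FiniteOver.exists_iterateKer_eq (h : FiniteOver L R M) (τ : SigmaPullback σ M →ₗ[R] M) :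
    ∃ n, iterateKer τ (n + 1) = iterateKer τ n := by
  by_contra! hne
  have hlt : ∀ n, n ≤ dimOver L R (iterateKer τ n) := fun n => by
    induction n with
    | zero => exact Nat.zero_le _
    | succ n ih =>
      have := h.dimOver_lt ((iterateKer_le_succ τ n).lt_of_ne (hne n).symm)
      omega
  have h1 := hlt (dimOver L R M + 1)
  have h2 : dimOver L R (iterateKer τ (dimOver L R M + 1)) ≤ dimOver L R M := by
    have : Module.Finite L (OverField L R M) := h
    exact LinearMap.finrank_le_finrank_of_injective
      (f := (iterateKer τ _).subtype.overField L R) (Submodule.subtype_injective _)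
  omega

theorem FiniteOver.exists_iterateRange_eq (h : FiniteOver L R M) (τ : SigmaPullback σ M →ₗ[R] M) :
    ∃ n, iterateRange τ (n + 1) = iterateRange τ n := by
  by_contra! hne
  have hlt : ∀ n, dimOver L R (iterateRange τ n) + n ≤ dimOver L R (iterateRange τ 0) := fun n => by
    induction n with
    | zero => exact le_rfl
    | succ n ih =>
      have := h.dimOver_lt ((iterateRange_succ_le τ n).lt_of_ne (hne n))
      omega
  have := hlt (dimOver L R (iterateRange τ 0) + 1)
  omega

theorem le_annihilator_coker_restrictTau {τ : SigmaPullback σ M →ₗ[R] M} {N : Submodule R M}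
    (hN : ∀ n ∈ N, semilinearOf τ n ∈ N) {I : Ideal R}
    (h : ∀ a ∈ I, ∀ x ∈ N, ∃ y : SigmaPullback σ N, τ (SigmaPullback.map σ N.subtype y) = a • x) :
    I ≤ Module.annihilator R (N ⧸ LinearMap.range (restrictTau τ N hN)) := by
  intro a ha
  rw [Module.mem_annihilator]
  intro x
  obtain ⟨x, rfl⟩ := Submodule.mkQ_surjective _ x
  rw [← map_smul, Submodule.mkQ_apply, Submodule.Quotient.mk_eq_zero]
  obtain ⟨y, hy⟩ := h a ha x x.2
  exact ⟨y, N.subtype_injective ((LinearMap.congr_fun (isTauMorphism_subtype τ N hN) y).trans hy)⟩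

theorem semilinearOf_mem_ker {τ : SigmaPullback σ M →ₗ[R] M} {τK : SigmaPullback σ K →ₗ[R] K}
    {ρ : M →ₗ[R] K} (hρ : IsTauMorphism τ τK ρ) :
    ∀ n ∈ LinearMap.ker ρ, semilinearOf τ n ∈ LinearMap.ker ρ := fun n hn => by
  rw [LinearMap.mem_ker] at hn ⊢
  rw [← hρ.apply_semilinearOf, hn, map_zero]

/-- The snake lemma by hand. For `x ∈ ker ρ` and `a ∈ I'` write `a x = τ y`; the image of `y` in
`σ^* K` lies in `ker τK`, so `b ∈ I` kills it. By right exactness of `σ^*`, `b y` comes from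
`σ^*(ker ρ)`. -/
theorem le_annihilator_coker_restrictTau_ker {τ : SigmaPullback σ M →ₗ[R] M}
    {τK : SigmaPullback σ K →ₗ[R] K} {ρ : M →ₗ[R] K} (hρ : IsTauMorphism τ τK ρ)
    (hρ' : Function.Surjective ρ) {I I' : Ideal R}
    (hI : I ≤ Module.annihilator R (LinearMap.ker τK))
    (hI' : I' ≤ Module.annihilator R (M ⧸ LinearMap.range τ)) :
    I * I' ≤ Module.annihilator R ((LinearMap.ker ρ) ⧸
      LinearMap.range (restrictTau τ (LinearMap.ker ρ) (semilinearOf_mem_ker hρ))) := by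
  rw [Ideal.mul_le]
  intro b hb a ha
  refine le_annihilator_coker_restrictTau (I := Ideal.span {b * a}) _ ?_
    (Ideal.mem_span_singleton_self _)
  intro c hc x hx
  obtain ⟨c, rfl⟩ := Ideal.mem_span_singleton'.mp hc
  have h1 := Module.mem_annihilator.mp (hI' ha) (Submodule.Quotient.mk x)
  rw [← Submodule.Quotient.mk_smul, Submodule.Quotient.mk_eq_zero] at h1
  obtain ⟨y, hy⟩ := h1
  have h2 : τK (SigmaPullback.map σ ρ y) = 0 := by
    refine (LinearMap.congr_fun hρ y).symm.trans ?_
    rw [LinearMap.comp_apply, hy, map_smul, LinearMap.mem_ker.mp hx, smul_zero]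
  have h3 := congrArg Subtype.val
    (Module.mem_annihilator.mp (hI hb) ⟨SigmaPullback.map σ ρ y, h2⟩)
  have h4 : SigmaPullback.map σ ρ (b • y) = 0 := (map_smul _ _ _).trans h3
  obtain ⟨z, hz⟩ := (SigmaPullback.map_exact (σ := σ) ρ.exact_subtype_ker_map hρ' _).mp h4
  exact ⟨c • z, by rw [map_smul, hz, map_smul, map_smul, hy, smul_smul, smul_smul, mul_assoc]⟩

theorem isTorsion_quotient_of_le {N N' : Submodule R M} (h : N ≤ N')
    (hN : Module.IsTorsion R (M ⧸ N)) : Module.IsTorsion R (M ⧸ N') := by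
  intro x
  obtain ⟨x, rfl⟩ := N'.mkQ_surjective x
  obtain ⟨a, ha⟩ := @hN (Submodule.Quotient.mk x)
  exact ⟨a, congrArg (Submodule.factor h) ha⟩

/-- A morphism `f` whose image is contained in the stable submodule `N`, as a morphism to `N`. -/
theorem isTauMorphism_codRestrict {τ : SigmaPullback σ M →ₗ[R] M}
    {τ' : SigmaPullback σ M' →ₗ[R] M'} {f : M →ₗ[R] M'} (hf : IsTauMorphism τ τ' f)
    {N : Submodule R M'} (hN : ∀ n ∈ N, semilinearOf τ' n ∈ N) (hfN : ∀ m, f m ∈ N) :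
    IsTauMorphism τ (restrictTau τ' N hN) (f.codRestrict N hfN) :=
  isTauMorphism_iff.mpr fun m => Subtype.ext <| by
    rw [semilinearOf_restrictTau, LinearMap.codRestrict_apply, hf.apply_semilinearOf,
      LinearMap.codRestrict_apply]

/-- The map from `N / f(M)` to `M' / f(M)` for a submodule `N` of `M'` which contains `f(M)`. -/
def codRestrictQuotientMap (f : M →ₗ[R] M') (N : Submodule R M') (hfN : ∀ m, f m ∈ N) :
    (N ⧸ LinearMap.range (f.codRestrict N hfN)) →ₗ[R] (M' ⧸ LinearMap.range f) :=
  Submodule.mapQ _ _ N.subtype (by rintro _ ⟨m, rfl⟩; exact ⟨m, rfl⟩)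

theorem codRestrictQuotientMap_injective (f : M →ₗ[R] M') (N : Submodule R M')
    (hfN : ∀ m, f m ∈ N) : Function.Injective (codRestrictQuotientMap f N hfN) := by
  rw [← LinearMap.ker_eq_bot, LinearMap.ker_eq_bot']
  intro x hx
  obtain ⟨x, rfl⟩ := Submodule.mkQ_surjective _ x
  obtain ⟨m, hm⟩ := (Submodule.Quotient.mk_eq_zero (LinearMap.range f)).mp hx
  exact (Submodule.Quotient.mk_eq_zero _).mpr ⟨m, Subtype.ext hm⟩

theorem IsIsogeny.codRestrict {τ : SigmaPullback σ M →ₗ[R] M}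
    {τ' : SigmaPullback σ M' →ₗ[R] M'} {f : M →ₗ[R] M'} (hf : IsIsogeny τ τ' f)
    {N : Submodule R M'} (hN : ∀ n ∈ N, semilinearOf τ' n ∈ N) (hfN : ∀ m, f m ∈ N) :
    IsIsogeny τ (restrictTau τ' N hN) (f.codRestrict N hfN) where
  isTauMorphism := isTauMorphism_codRestrict hf.isTauMorphism hN hfN
  injective := fun _ _ h => hf.injective (congrArg Subtype.val h)
  torsion := by
    intro x
    obtain ⟨a, ha⟩ := @hf.torsion (codRestrictQuotientMap f N hfN x)
    refine ⟨a, codRestrictQuotientMap_injective f N hfN ?_⟩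
    rw [map_zero, ← ha]
    exact map_smul (codRestrictQuotientMap f N hfN) (a : R) x

theorem IsIsogeny.subtype {τ : SigmaPullback σ M →ₗ[R] M}
    {τ' : SigmaPullback σ M' →ₗ[R] M'} {f : M →ₗ[R] M'} (hf : IsIsogeny τ τ' f)
    {N : Submodule R M'} (hN : ∀ n ∈ N, semilinearOf τ' n ∈ N) (hfN : ∀ m, f m ∈ N) :
    IsIsogeny (restrictTau τ' N hN) τ' N.subtype where
  isTauMorphism := isTauMorphism_subtype τ' N hN
  injective := N.subtype_injective
  torsion := isTorsion_quotient_of_le (by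
    rintro _ ⟨m, rfl⟩
    exact ⟨⟨f m, hfN m⟩, rfl⟩) hf.torsion

end TauSubmodules

/-! ### The two factorizations of an isogeny -/

section Factorizations

variable {Fq L A : Type*} [Field Fq] [Fintype Fq] [Field L] [Algebra Fq L] [CommRing A]
  [Algebra Fq A] {M M' : Type*} [AddCommGroup M] [Module (L ⊗[Fq] A) M] [AddCommGroup M']
  [Module (L ⊗[Fq] A) M']

/-- `N` is the preimage of the stable image of `ψ`. The crux is `N = f(M) + τ'(σ^* N)`: it makes `τ`
surjective on `N / f(M)`, and it makes the cokernel on `N` a quotient of that on `M`, which gives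
the inclusion of annihilators. -/
theorem IsIsogeny.exists_separable_comp_inseparable
    {τ : SigmaPullback (sigmaHom Fq L A) M →ₗ[L ⊗[Fq] A] M}
    {τ' : SigmaPullback (sigmaHom Fq L A) M' →ₗ[L ⊗[Fq] A] M'} {f : M →ₗ[L ⊗[Fq] A] M'}
    (hf : IsIsogeny τ τ' f) (hK : FiniteOver L (L ⊗[Fq] A) (M' ⧸ LinearMap.range f)) :
    ∃ (N : Submodule (L ⊗[Fq] A) M') (hN : ∀ n ∈ N, semilinearOf τ' n ∈ N)
      (g : M →ₗ[L ⊗[Fq] A] N), IsSeparableIsogeny τ (restrictTau τ' N hN) g ∧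
      IsPurelyInseparableIsogeny (restrictTau τ' N hN) τ' N.subtype ∧
      f = N.subtype ∘ₗ g ∧
      Module.annihilator (L ⊗[Fq] A) (M ⧸ LinearMap.range τ) ≤
        Module.annihilator (L ⊗[Fq] A) (N ⧸ LinearMap.range (restrictTau τ' N hN)) := by
  set ψ := cokerTau hf.isTauMorphism with hψ
  obtain ⟨n, hn⟩ := hK.exists_iterateRange_eq ψ
  let N := (iterateRange ψ n).comap (LinearMap.range f).mkQ
  have hmem : ∀ x, x ∈ N ↔ (Submodule.Quotient.mk x : M' ⧸ LinearMap.range f) ∈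
    iterateRange ψ n := fun x => Iff.rfl
  have hψV : ∀ v ∈ iterateRange ψ n, semilinearOf ψ v ∈ iterateRange ψ n := by
    intro v hv
    rw [← hn]
    induction hv using Submodule.span_induction with
    | mem v hv =>
      obtain ⟨k, rfl⟩ := hv
      refine Submodule.subset_span ⟨k, ?_⟩
      rw [Function.iterate_succ_apply']
    | zero => rw [map_zero]; exact zero_mem _
    | add x y _ _ hx hy => rw [map_add]; exact add_mem hx hy
    | smul a x _ hx => rw [map_smulₛₗ]; exact Submodule.smul_mem _ _ hx
  have hN : ∀ x ∈ N, semilinearOf τ' x ∈ N := fun x hx => by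
    rw [hmem, ← semilinearOf_cokerTau hf.isTauMorphism]
    exact hψV _ hx
  have hfN : ∀ m, f m ∈ N := fun m => by
    rw [hmem, (Submodule.Quotient.mk_eq_zero _).mpr (LinearMap.mem_range_self f m)]
    exact zero_mem _
  have hdec : ∀ x ∈ N, ∃ (m : M) (y : SigmaPullback (sigmaHom Fq L A) N),
      x = f m + (restrictTau τ' N hN y : N) := by
    intro x hx
    have key : ∀ v ∈ iterateRange ψ (n + 1), ∃ y : SigmaPullback (sigmaHom Fq L A) N,
        Submodule.Quotient.mk ((restrictTau τ' N hN y : N) : M') = v := by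
      intro v hv
      induction hv using Submodule.span_induction with
      | mem v hv =>
        obtain ⟨k, rfl⟩ := hv
        obtain ⟨k, rfl⟩ := Submodule.mkQ_surjective _ k
        have hk : (semilinearOf τ')^[n] k ∈ N := by
          rw [hmem, ← semilinearOf_cokerTau_iterate hf.isTauMorphism]
          exact Submodule.subset_span ⟨_, rfl⟩
        refine ⟨SigmaPullback.tmul _ 1 ⟨_, hk⟩, ?_⟩
        rw [Submodule.mkQ_apply, hψ, semilinearOf_cokerTau_iterate,
          Function.iterate_succ_apply']
        exact congrArg _ (semilinearOf_restrictTau τ' N hN ⟨_, hk⟩)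
      | zero => exact ⟨0, by rw [map_zero]; rfl⟩
      | add x y _ _ hx hy =>
        obtain ⟨a, rfl⟩ := hx
        obtain ⟨b, rfl⟩ := hy
        exact ⟨a + b, by rw [map_add]; rfl⟩
      | smul r x _ hx =>
        obtain ⟨a, rfl⟩ := hx
        exact ⟨r • a, by rw [map_smul]; rfl⟩
    rw [hmem, ← hn] at hx
    obtain ⟨y, hy⟩ := key _ hx
    obtain ⟨m, hm⟩ := (Submodule.Quotient.eq _).mp hy.symm
    exact ⟨m, y, by rw [hm]; abel⟩
  have hg := hf.codRestrict hN hfN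
  refine ⟨N, hN, f.codRestrict N hfN, ⟨hg, ?_⟩, ⟨hf.subtype hN hfN, n, fun x => ?_⟩, rfl, ?_⟩
  · have hfin : FiniteOver L (L ⊗[Fq] A) (N ⧸ LinearMap.range (f.codRestrict N hfN)) :=
      hK.of_injective _ (codRestrictQuotientMap_injective f N hfN)
    -- `σ^*` preserves the dimension of `N / f(M)`, so surjectivity is enough.
    refine bijective_of_surjective_of_dimOver_eq hfin.sigmaPullback.1 _ ?_ hfin.sigmaPullback.2
    intro x
    obtain ⟨x, rfl⟩ := Submodule.mkQ_surjective _ x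
    obtain ⟨m, y, hy⟩ := hdec x x.2
    refine ⟨SigmaPullback.map _ (LinearMap.range (f.codRestrict N hfN)).mkQ y, ?_⟩
    have h1 : IsTauMorphism (restrictTau τ' N hN) (cokerTau hg.isTauMorphism)
        (LinearMap.range (f.codRestrict N hfN)).mkQ :=
      isTauMorphism_iff.mpr fun z => semilinearOf_cokerTau hg.isTauMorphism z
    refine (LinearMap.congr_fun h1 y).symm.trans ?_
    refine (Submodule.Quotient.eq _).mpr ⟨-m, Subtype.ext ?_⟩
    change f (-m) = ((restrictTau τ' N hN y : N) : M') - x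
    rw [hy, map_neg]
    abel
  · obtain ⟨x, rfl⟩ := Submodule.mkQ_surjective _ x
    rw [Submodule.mkQ_apply, semilinearOf_cokerTau_iterate, Submodule.Quotient.mk_eq_zero,
      Submodule.range_subtype, hmem, ← semilinearOf_cokerTau_iterate hf.isTauMorphism]
    exact Submodule.subset_span ⟨_, rfl⟩
  · intro a ha
    rw [Module.mem_annihilator] at ha ⊢
    intro x
    obtain ⟨x, rfl⟩ := Submodule.mkQ_surjective _ x
    obtain ⟨m, y, hy⟩ := hdec x x.2
    have h1 := ha (Submodule.Quotient.mk m)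
    rw [← Submodule.Quotient.mk_smul, Submodule.Quotient.mk_eq_zero] at h1
    obtain ⟨z, hz⟩ := h1
    rw [← map_smul, Submodule.mkQ_apply, Submodule.Quotient.mk_eq_zero]
    -- Here `x = f m + τ' y` and `a m = τ z`, whence `a x = τ'(σ^* f z + a y)`.
    refine ⟨SigmaPullback.map _ (f.codRestrict N hfN) z + a • y, ?_⟩
    rw [map_add, map_smul]
    have h2 := LinearMap.congr_fun hg.isTauMorphism z
    rw [LinearMap.comp_apply, LinearMap.comp_apply, hz] at h2
    rw [← h2]
    apply Subtype.ext
    change f (a • m) + a • ((restrictTau τ' N hN y : N) : M') = a • (x : M')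
    rw [hy, smul_add, map_smul]

/-- `N` is the preimage of the stable kernel of `ψ`, so that `τ'(1 ⊗ x) ∈ N` holds exactly for `x ∈
N`. Together with the form `1 ⊗ m` of all elements of `σ^*`, this makes `τ'` injective on `M' / N`
and embeds the cokernel on `N` into that on `M'`. -/
theorem IsIsogeny.exists_inseparable_comp_separable
    (hσ : Function.Surjective (sigmaHom Fq L A))
    {τ : SigmaPullback (sigmaHom Fq L A) M →ₗ[L ⊗[Fq] A] M}
    {τ' : SigmaPullback (sigmaHom Fq L A) M' →ₗ[L ⊗[Fq] A] M'} {f : M →ₗ[L ⊗[Fq] A] M'}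
    (hf : IsIsogeny τ τ' f) (hK : FiniteOver L (L ⊗[Fq] A) (M' ⧸ LinearMap.range f)) :
    ∃ (N : Submodule (L ⊗[Fq] A) M') (hN : ∀ n ∈ N, semilinearOf τ' n ∈ N)
      (g : M →ₗ[L ⊗[Fq] A] N), IsPurelyInseparableIsogeny τ (restrictTau τ' N hN) g ∧
      IsSeparableIsogeny (restrictTau τ' N hN) τ' N.subtype ∧
      f = N.subtype ∘ₗ g ∧
      Module.annihilator (L ⊗[Fq] A) (M' ⧸ LinearMap.range τ') ≤
        Module.annihilator (L ⊗[Fq] A) (N ⧸ LinearMap.range (restrictTau τ' N hN)) := by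
  set ψ := cokerTau hf.isTauMorphism with hψ
  obtain ⟨n, hn⟩ := hK.exists_iterateKer_eq ψ
  let N := (iterateKer ψ n).comap (LinearMap.range f).mkQ
  have hmem : ∀ x, x ∈ N ↔ (Submodule.Quotient.mk x : M' ⧸ LinearMap.range f) ∈
    iterateKer ψ n := fun x => Iff.rfl
  have hN : ∀ x, semilinearOf τ' x ∈ N ↔ x ∈ N := fun x => by
    rw [hmem, hmem, ← semilinearOf_cokerTau hf.isTauMorphism]
    -- Only with the kernel of the next iterate on the right do the two conditions coincide:
    -- applying `ψ` once uses up one iterate.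
    conv_rhs => rw [← hn]
    exact Iff.rfl
  have hfN : ∀ m, f m ∈ N := fun m => by
    rw [hmem, (Submodule.Quotient.mk_eq_zero _).mpr (LinearMap.mem_range_self f m)]
    exact zero_mem _
  have hN' : ∀ x ∈ N, semilinearOf τ' x ∈ N := fun x hx => (hN x).mpr hx
  have hg := hf.codRestrict hN' hfN
  have hh := hf.subtype hN' hfN
  refine ⟨N, hN', f.codRestrict N hfN, ⟨hg, n, fun x => ?_⟩, ⟨hh, ?_⟩, rfl, ?_⟩
  · obtain ⟨x, rfl⟩ := Submodule.mkQ_surjective _ x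
    rw [Submodule.mkQ_apply, semilinearOf_cokerTau_iterate, Submodule.Quotient.mk_eq_zero]
    have h1 : (semilinearOf ψ)^[n] (Submodule.Quotient.mk (x : M')) = 0 := x.2
    rw [hψ, semilinearOf_cokerTau_iterate, Submodule.Quotient.mk_eq_zero] at h1
    obtain ⟨m, hm⟩ := h1
    refine ⟨m, Subtype.ext ?_⟩
    rw [LinearMap.codRestrict_apply, hm]
    have hs : Function.Semiconj N.subtype (semilinearOf (restrictTau τ' N hN'))
      (semilinearOf τ') := fun z => semilinearOf_restrictTau τ' N hN' z
    exact ((hs.iterate_right n) x).symm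
  · have hfin : FiniteOver L (L ⊗[Fq] A) (M' ⧸ LinearMap.range N.subtype) :=
      hK.of_surjective (Submodule.factor (by
        rintro _ ⟨m, rfl⟩
        exact ⟨⟨f m, hfN m⟩, rfl⟩)) (Submodule.factor_surjective _)
    refine bijective_of_injective_of_dimOver_eq hfin.sigmaPullback.1 hfin _ ?_
      hfin.sigmaPullback.2
    rw [← LinearMap.ker_eq_bot, LinearMap.ker_eq_bot']
    intro x hx
    obtain ⟨x, rfl⟩ := SigmaPullback.exists_eq_tmul_one hσ x
    obtain ⟨x, rfl⟩ := Submodule.mkQ_surjective _ x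
    have h1 : (Submodule.Quotient.mk (semilinearOf τ' x) : M' ⧸ LinearMap.range N.subtype) = 0 :=
      (semilinearOf_cokerTau hh.isTauMorphism x).symm.trans hx
    rw [Submodule.Quotient.mk_eq_zero, Submodule.range_subtype, hN] at h1
    rw [Submodule.mkQ_apply, (Submodule.Quotient.mk_eq_zero _).mpr (by
      rw [Submodule.range_subtype]; exact h1)]
    exact map_zero (SigmaPullback.unit (sigmaHom Fq L A))
  · refine le_annihilator_coker_restrictTau hN' fun a ha x hx => ?_
    have h1 := Module.mem_annihilator.mp ha (Submodule.Quotient.mk x)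
    rw [← Submodule.Quotient.mk_smul, Submodule.Quotient.mk_eq_zero] at h1
    obtain ⟨y, hy⟩ := h1
    obtain ⟨m, rfl⟩ := SigmaPullback.exists_eq_tmul_one hσ y
    have hm : m ∈ N := by
      rw [← hN]
      change τ' (SigmaPullback.tmul _ 1 m) ∈ N
      rw [hy]
      exact N.smul_mem a hx
    exact ⟨SigmaPullback.tmul _ 1 ⟨m, hm⟩, by rw [SigmaPullback.map_tmul]; exact hy⟩

theorem sigmaHom_surjective [PerfectField L] : Function.Surjective (sigmaHom Fq L A) := by
  have hfrob : ∀ l : L, ∃ l' : L, l' ^ Fintype.card Fq = l := by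
    obtain ⟨p, hp⟩ := CharP.exists Fq
    obtain ⟨n, hprime, hn⟩ := FiniteField.card Fq p
    have := Fact.mk hprime
    have : CharP L p := charP_of_injective_algebraMap (algebraMap Fq L).injective p
    have : ExpChar L p := .prime hprime
    have : PerfectRing L p := PerfectField.toPerfectRing p
    intro l
    obtain ⟨l', hl'⟩ := (bijective_iterateFrobenius L p n).2 l
    exact ⟨l', by rw [hn, ← iterateFrobenius_def]; exact hl'⟩
  intro x
  induction x with
  | zero => exact ⟨0, map_zero _⟩
  | add x y hx hy =>
    obtain ⟨x, rfl⟩ := hx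
    obtain ⟨y, rfl⟩ := hy
    exact ⟨x + y, map_add _ _ _⟩
  | tmul l a =>
    obtain ⟨l', rfl⟩ := hfrob l
    exact ⟨l' ⊗ₜ a, rfl⟩

end Factorizations

/-! ### Kernels of equivariant surjections -/

section Kernel

variable {R : Type*} [CommRing R] {σ : R →+* R} {M K : Type*} [AddCommGroup M] [Module R M]
  [AddCommGroup K] [Module R K]

theorem isIsogeny_subtype_ker {τ : SigmaPullback σ M →ₗ[R] M} {τK : SigmaPullback σ K →ₗ[R] K}
    {ρ : M →ₗ[R] K} (hρ : IsTauMorphism τ τK ρ) (hK : Module.IsTorsion R K) :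
    IsIsogeny (restrictTau τ (LinearMap.ker ρ) (semilinearOf_mem_ker hρ)) τ
      (LinearMap.ker ρ).subtype where
  isTauMorphism := isTauMorphism_subtype τ _ _
  injective := Submodule.subtype_injective _
  torsion := by
    intro x
    obtain ⟨x, rfl⟩ := Submodule.mkQ_surjective _ x
    obtain ⟨a, ha⟩ := @hK (ρ x)
    refine ⟨a, (Submodule.Quotient.mk_eq_zero _).mpr ?_⟩
    rw [Submodule.range_subtype, LinearMap.mem_ker]
    exact (map_smul ρ (a : R) x).trans ha

theorem exists_cokerTau_equiv {τ : SigmaPullback σ M →ₗ[R] M} {τK : SigmaPullback σ K →ₗ[R] K}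
    {ρ : M →ₗ[R] K} (hρ : IsTauMorphism τ τK ρ) (hρ' : Function.Surjective ρ)
    {τ' : SigmaPullback σ (LinearMap.ker ρ) →ₗ[R] LinearMap.ker ρ}
    (h : IsTauMorphism τ' τ (LinearMap.ker ρ).subtype) :
    ∃ e : (M ⧸ LinearMap.range (LinearMap.ker ρ).subtype) ≃ₗ[R] K,
      (∀ m : M, e (Submodule.Quotient.mk m) = ρ m) ∧
        IsTauMorphism (cokerTau h) τK e.toLinearMap := by
  refine ⟨Submodule.quotEquivOfEq _ _ (Submodule.range_subtype _) ≪≫ₗ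
    ρ.quotKerEquivOfSurjective hρ', fun m => rfl, isTauMorphism_iff.mpr fun x => ?_⟩
  obtain ⟨x, rfl⟩ := Submodule.mkQ_surjective _ x
  rw [Submodule.mkQ_apply, semilinearOf_cokerTau]
  exact hρ.apply_semilinearOf x

end Kernel

/-! ### The theorem -/

set_option maxHeartbeats 4000000 in
theorem mainTheorem12 {Fq : Type u₁} {Q : Type u₂} {L : Type u₃} [Field Fq] [Fintype Fq]
    [Field Q] [Algebra Fq Q] [Field L] [Algebra Fq L] (hQ : IsCurveFunctionField Fq Q)
    (P : RationalPoint Fq Q) (c : P.ringAway →ₐ[Fq] L) :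
    -- kernels of equivariant surjections onto suitable torsion modules
    (∀ (M : PureAMotive.{u₁, u₂, u₃, u₄} P c) (K : Type u₅) [AddCommGroup K] [Module (P.AL L) K]
        (τK : SigmaPullback (P.sigma L) K →ₗ[P.AL L] K) (ρ : M.carrier →ₗ[P.AL L] K),
      Module.Finite (P.AL L) K → Module.IsTorsion (P.AL L) K →
      (∃ n : ℕ, P.idealJ c ^ n ≤ Module.annihilator (P.AL L) (LinearMap.ker τK)) →
      (∃ n : ℕ, P.idealJ c ^ n ≤ Module.annihilator (P.AL L) (K ⧸ LinearMap.range τK)) →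
      Function.Surjective ρ → IsTauMorphism M.tau τK ρ →
      ∃ (τ' : SigmaPullback (P.sigma L) (LinearMap.ker ρ) →ₗ[P.AL L] LinearMap.ker ρ)
        (hf : IsIsogeny τ' M.tau (LinearMap.ker ρ).subtype),
        P.IsPureAMotive c M.rank M.dim τ' ∧
        ∃ e : (M.carrier ⧸ LinearMap.range (LinearMap.ker ρ).subtype) ≃ₗ[P.AL L] K,
          (∀ m : M.carrier, e (Submodule.Quotient.mk m) = ρ m) ∧
          IsTauMorphism (cokerTau hf.isTauMorphism) τK e.toLinearMap) ∧
    -- a separable isogeny followed by a purely inseparable one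
    (∀ (M M' : PureAMotive.{u₁, u₂, u₃, u₄} P c) (f : M.carrier →ₗ[P.AL L] M'.carrier),
      IsIsogeny M.tau M'.tau f →
      ∃ (M'' : PureAMotive.{u₁, u₂, u₃, u₄} P c) (g : M.carrier →ₗ[P.AL L] M''.carrier)
        (h : M''.carrier →ₗ[P.AL L] M'.carrier),
        IsSeparableIsogeny M.tau M''.tau g ∧ IsPurelyInseparableIsogeny M''.tau M'.tau h ∧
        f = h ∘ₗ g) ∧
    -- over a perfect field, a purely inseparable isogeny followed by a separable one
    (PerfectField L →
      ∀ (M M' : PureAMotive.{u₁, u₂, u₃, u₄} P c) (f : M.carrier →ₗ[P.AL L] M'.carrier),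
      IsIsogeny M.tau M'.tau f →
      ∃ (M'' : PureAMotive.{u₁, u₂, u₃, u₄} P c) (g : M.carrier →ₗ[P.AL L] M''.carrier)
        (h : M''.carrier →ₗ[P.AL L] M'.carrier),
        IsPurelyInseparableIsogeny M.tau M''.tau g ∧ IsSeparableIsogeny M''.tau M'.tau h ∧
        f = h ∘ₗ g) := by
  have hfinAL := (P.isDedekindDomain_AL hQ L).2
  have hDed := (P.isDedekindDomain_AL hQ L).1
  refine ⟨?_, ?_, ?_⟩
  · intro M K _ _ τK ρ _ hK hker _ hsurj hρ
    obtain ⟨n, hn⟩ := hker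
    have hf := isIsogeny_subtype_ker hρ hK
    have hann := le_annihilator_coker_restrictTau_ker hρ hsurj hn
      M.isPureAMotive.coker_annihilated
    rw [← pow_add] at hann
    exact ⟨_, hf, M.isPureAMotive.of_isIsogeny hQ hf ⟨_, hann⟩,
      exists_cokerTau_equiv hρ hsurj hf.isTauMorphism⟩
  · intro M M' f hf
    have hfin := M'.isPureAMotive.finite
    obtain ⟨N, hN, g, hg, hh, hfg, hann⟩ :=
      hf.exists_separable_comp_inseparable (FiniteOver.of_isTorsion hfinAL hf.torsion)
    -- The power of `J` comes from the source `M`, whereas the remaining properties come from the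
    -- target `M'`.
    have hpure := M'.isPureAMotive.of_isIsogeny hQ hh.toIsIsogeny
      ⟨M.dim, M.isPureAMotive.coker_annihilated.trans hann⟩
    exact ⟨⟨N, M'.rank, M'.dim, _, hpure⟩, g, N.subtype, hg, hh, hfg⟩
  · intro hL M M' f hf
    have hfin := M'.isPureAMotive.finite
    obtain ⟨N, hN, g, hg, hh, hfg, hann⟩ := hf.exists_inseparable_comp_separable
      sigmaHom_surjective (FiniteOver.of_isTorsion hfinAL hf.torsion)
    -- Here the power of `J` comes from the target as well.
    have hpure := M'.isPureAMotive.of_isIsogeny hQ hh.toIsIsogeny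
      ⟨M'.dim, M'.isPureAMotive.coker_annihilated.trans hann⟩
    exact ⟨⟨N, M'.rank, M'.dim, _, hpure⟩, g, N.subtype, hg, hh, hfg⟩
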